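/- Let $m\ge 0$ be an integer and let $V=V_{\tau_m}$ be the space of complex-valued harmonic homogeneous polynomials of degree $m$ on $\mathbb{R}^3$, with the representation $(\tau_m(k)p)(x)=p(k^{-1}x)$ of $SO(3)$. Let $d\tau_m$ be the derived representation of $so(3)$, let $$Y_1=\begin{pmatrix}0&0&0\\0&0&1\\0&-1&0\end{pmatrix},\quad Y_2=\begin{pmatrix}0&0&-1\\0&0&0\\1&0&0\end{pmatrix},\quad Y_3=\begin{pmatrix}0&1&0\\-1&0&0\\0&0&0\end{pmatrix},$$ and put $Q_1(x)=d\tau_m(x):=\sum_{i=1}^3 x_i\,d\tau_m(Y_i)$ for $x\in\mathbb{R}^3$ and $D_\tau:=\sum_{i=1}^3\frac{\partial}{\partial x_i}d\tau_m(Y_i)$, a differential operator on $End(V)$-valued polynomials. Let $\mathcal{P}_{\tau_m}$ be the $\mathbb{C}[|x|^2]$-module of all $End(V)$-valued polynomials $P$ on $\mathbb{R}^3$ with $P(kx)=\tau_m(k)P(x)\tau_m(k)^{-1}$ for all $k\in SO(3)$ and $x\in\mathbb{R}^3$. Then $\mathcal{P}_{\tau_m}$ is generated as a $\mathbb{C}[|x|^2]$-module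 by the powers $Q_1^j$, $0\le j\le 2m$. Moreover, there are $End(V)$-valued polynomials $Q_j$, starting with $Q_0=I$ and $Q_1=d\tau_m$, such that 1. for $0\le j\le 2m$, $Q_j\neq 0$ and the elements of $\mathcal{P}_{\tau_m}$ all of whose matrix entries are harmonic homogeneous polynomials of degree $j$ are exactly the complex multiples of $Q_j$; 2. for $1\le j\le 2m$, $D_\tau Q_j=a_jQ_{j-1}$ with $a_j=\frac{j^2}{2j-1}\left(-m(m+1)+\frac{j^2-1}{4}\right)$; 3. for $1\le j<2m$, $$Q_{j+1}=Q_1Q_j-\frac{|x|^2}{2j+1}D_\tau Q_j=Q_1Q_j-\frac{a_j}{2j+1}\,|x|^2\,Q_{j-1};$$ 4. $\mathcal{P}_{\tau_m}$ is generated as a $\mathbb{C}[|x|^2]$-module by $Q_0,Q_1,\dots,Q_{2m}$. -/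

import Mathlib

open MvPolynomial TensorProduct

noncomputable section

namespace EuclideanMotion

/-! ### Scalar polynomials on `ℝ³` -/

/-- Complex-valued polynomials on `ℝ³`. -/
abbrev Poly : Type := MvPolynomial (Fin 3) ℂ

/-- The value of a polynomial at a point of `ℝ³`. -/
def evalAt (x : Fin 3 → ℝ) : Poly →ₐ[ℂ] ℂ := aeval fun i => (x i : ℂ)

/-- The Laplacian `Δ = ∑ ∂ᵢ²`. -/
def laplacian : Poly →ₗ[ℂ] Poly :=
  ∑ i : Fin 3, ((pderiv i : Derivation ℂ Poly Poly) : Poly →ₗ[ℂ] Poly) ∘ₗ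
    ((pderiv i : Derivation ℂ Poly Poly) : Poly →ₗ[ℂ] Poly)

/-- The space `H_n` of harmonic homogeneous polynomials of degree `n` on `ℝ³`. -/
def harmonic (n : ℕ) : Submodule ℂ Poly :=
  homogeneousSubmodule (Fin 3) ℂ n ⊓ LinearMap.ker laplacian

/-- The polynomial `|x|² = x₁² + x₂² + x₃²`. -/
def normSqPoly : Poly := ∑ i : Fin 3, X i ^ 2

/-- The algebra `ℂ[|x|²]`. -/
def radialPoly : Subalgebra ℂ Poly := Algebra.adjoin ℂ {normSqPoly}

/-! ### The representation of `SO(3)` on `H_m` -/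

/-- The rotation group `SO(3)`. -/
abbrev SO3 : Type := Matrix.specialOrthogonalGroup (Fin 3) ℝ

/-- The substitution `p ↦ (x ↦ p (A x))`. -/
def subst (A : Matrix (Fin 3) (Fin 3) ℝ) : Poly →ₐ[ℂ] Poly :=
  aeval fun i => ∑ j : Fin 3, C (A i j : ℂ) * X j

theorem evalAt_subst (A : Matrix (Fin 3) (Fin 3) ℝ) (x : Fin 3 → ℝ) (p : Poly) :
    evalAt x (subst A p) = evalAt (A.mulVec x) p := by
  have h : (evalAt x).comp (subst A) = evalAt (A.mulVec x) := by
    apply MvPolynomial.algHom_ext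
    intro i
    simp [evalAt, subst, Matrix.mulVec, dotProduct]
  exact DFunLike.congr_fun h p

theorem subst_one (p : Poly) : subst 1 p = p := by
  have h : subst 1 = AlgHom.id ℂ Poly := by
    apply MvPolynomial.algHom_ext
    intro i
    fin_cases i <;> simp [subst, Fin.sum_univ_three]
  exact DFunLike.congr_fun h p

theorem subst_subst (A B : Matrix (Fin 3) (Fin 3) ℝ) (p : Poly) :
    subst B (subst A p) = subst (A * B) p := by
  have h : (subst B).comp (subst A) = subst (A * B) := by
    apply MvPolynomial.algHom_ext
    intro i
    simp only [subst, AlgHom.comp_apply, aeval_X, map_sum, map_mul, Matrix.mul_apply,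
      algHom_C, algebraMap_eq, Complex.ofReal_sum, Complex.ofReal_mul, Finset.mul_sum,
      Finset.sum_mul]
    rw [Finset.sum_comm]
    simp only [mul_assoc]
  exact DFunLike.congr_fun h p

theorem pderiv_subst (A : Matrix (Fin 3) (Fin 3) ℝ) (i : Fin 3) (p : Poly) :
    pderiv i (subst A p) = ∑ j : Fin 3, C (A j i : ℂ) * subst A (pderiv j p) := by
  induction p using MvPolynomial.induction_on with
  | C a => simp [subst]
  | add p q hp hq => simp [hp, hq, mul_add, Finset.sum_add_distrib]
  | mul_X p n hp =>
    have hX : pderiv i (subst A (X n)) = C (A n i : ℂ) := by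
      simp [subst, Derivation.leibniz, pderiv_X, Pi.single_apply, eq_comm]
    have hl : ∀ j : Fin 3, pderiv j (p * X n) = p * pderiv j (X n) + X n * pderiv j p :=
      fun j => Derivation.leibniz _ _ _
    have hd : ∀ j : Fin 3, subst A (pderiv j (X n)) = if j = n then 1 else 0 := by
      intro j
      rw [pderiv_X, Pi.single_apply]
      by_cases h : j = n
      · simp [h]
      · simp [h, Ne.symm h]
    have hr : pderiv i (subst A p * subst A (X n)) =
        subst A p * pderiv i (subst A (X n)) + subst A (X n) * pderiv i (subst A p) :=
      Derivation.leibniz _ _ _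
    rw [map_mul, hr, hX, hp]
    simp only [hl, map_add, map_mul, hd, mul_add, Finset.sum_add_distrib, mul_ite, mul_one,
      mul_zero, Finset.sum_ite_eq', Finset.mem_univ, if_true, Finset.mul_sum]
    rw [mul_comm]
    exact congrArg _ (Finset.sum_congr rfl fun j _ => mul_left_comm _ _ _)

theorem laplacian_apply (p : Poly) : laplacian p = ∑ i : Fin 3, pderiv i (pderiv i p) := by
  simp [laplacian]

theorem laplacian_subst {A : Matrix (Fin 3) (Fin 3) ℝ} (hA : A * A.transpose = 1) (p : Poly) :
    laplacian (subst A p) = subst A (laplacian p) := by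
  have hA' : ∀ j l : Fin 3, ∑ i : Fin 3, (C (A j i : ℂ) * C (A l i : ℂ) : Poly) =
      if j = l then 1 else 0 := by
    intro j l
    have h := congrFun (congrFun hA j) l
    rw [Matrix.mul_apply, Matrix.one_apply] at h
    simp only [Matrix.transpose_apply] at h
    have h' : ∑ i : Fin 3, ((A j i : ℂ) * (A l i : ℂ)) = if j = l then 1 else 0 := by
      have := congrArg (fun t : ℝ => (t : ℂ)) h
      simp only [Complex.ofReal_sum, Complex.ofReal_mul] at this
      rw [this]; split <;> simp
    have h3 := congrArg (C : ℂ → Poly) h'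
    rw [map_sum] at h3
    simp only [C_mul] at h3
    rw [h3]; split <;> simp
  have hC : ∀ (i : Fin 3) (a : ℂ) (q : Poly), pderiv i (C a * q) = C a * pderiv i q :=
    fun i a q => pderiv_C_mul
  simp only [laplacian_apply, pderiv_subst, map_sum, hC, Finset.mul_sum]
  rw [Finset.sum_comm]
  refine Finset.sum_congr rfl fun j _ => ?_
  rw [Finset.sum_comm]
  have h : ∀ l : Fin 3,
      ∑ i : Fin 3, C (A j i : ℂ) * (C (A l i : ℂ) * subst A (pderiv l (pderiv j p)))
      = (if j = l then 1 else 0) * subst A (pderiv l (pderiv j p)) := by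
    intro l
    rw [← hA' j l, Finset.sum_mul]
    exact Finset.sum_congr rfl fun i _ => (mul_assoc _ _ _).symm
  simp only [h, ite_mul, one_mul, zero_mul, Finset.sum_ite_eq, Finset.mem_univ, if_true]

theorem subst_mem_harmonic {A : Matrix (Fin 3) (Fin 3) ℝ} (hA : A * A.transpose = 1) {n : ℕ}
    {p : Poly} (hp : p ∈ harmonic n) : subst A p ∈ harmonic n := by
  obtain ⟨h1, h2⟩ := hp
  refine ⟨?_, ?_⟩
  · have h1' : p.IsHomogeneous n := h1
    have := h1'.aeval (fun i => ∑ j : Fin 3, C (A i j : ℂ) * X j) (n := 1) (fun i =>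
      IsHomogeneous.sum _ _ _ fun j _ => isHomogeneous_C_mul_X _ _)
    simpa [subst] using this
  · have h2' : laplacian p = 0 := h2
    change laplacian (subst A p) = 0
    rw [laplacian_subst hA, h2', map_zero]

theorem SO3.mul_transpose (k : SO3) : (k : Matrix (Fin 3) (Fin 3) ℝ) *
    (k : Matrix (Fin 3) (Fin 3) ℝ).transpose = 1 :=
  (Matrix.mem_orthogonalGroup_iff (Fin 3) ℝ).1
    ((Matrix.mem_specialOrthogonalGroup_iff).1 k.2).1

/-- The representation `τ_m` of `SO(3)` on `H_m`: `(τ_m(k) p)(x) = p (k⁻¹ x)`. -/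
def tau (m : ℕ) : Representation ℂ SO3 (harmonic m) where
  toFun k := (subst ((k⁻¹ : SO3) : Matrix (Fin 3) (Fin 3) ℝ)).toLinearMap.restrict
    fun p hp => subst_mem_harmonic (p := p) (SO3.mul_transpose k⁻¹) hp
  map_one' := by
    refine LinearMap.ext fun p => Subtype.ext ?_
    change subst ((1⁻¹ : SO3) : Matrix (Fin 3) (Fin 3) ℝ) (p : Poly) = p
    rw [inv_one]
    exact subst_one _
  map_mul' k l := by
    refine LinearMap.ext fun p => Subtype.ext ?_
    change subst (((k * l)⁻¹ : SO3) : Matrix (Fin 3) (Fin 3) ℝ) (p : Poly) =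
      subst ((k⁻¹ : SO3) : Matrix (Fin 3) (Fin 3) ℝ)
        (subst ((l⁻¹ : SO3) : Matrix (Fin 3) (Fin 3) ℝ) (p : Poly))
    rw [subst_subst, mul_inv_rev]
    rfl

theorem evalAt_tau (m : ℕ) (k : SO3) (p : harmonic m) (x : Fin 3 → ℝ) :
    evalAt x (tau m k p : Poly) =
      evalAt (((k⁻¹ : SO3) : Matrix (Fin 3) (Fin 3) ℝ).mulVec x) p :=
  evalAt_subst _ _ _

/-! ### The derived representation of `so(3)` on `H_m` -/

/-- The Lie algebra `so(3)` of skew-symmetric real matrices. -/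
abbrev LieSO3 : Type := LieAlgebra.Orthogonal.so (Fin 3) ℝ

/-- The vector field `p ↦ (x ↦ d/dt p (exp (-tA) x) |_{t=0})`, that is
`p ↦ - ∑ᵢ (A x)ᵢ ∂ᵢ p`. -/
def vectorField (A : Matrix (Fin 3) (Fin 3) ℝ) : Poly →ₗ[ℂ] Poly :=
  -∑ i : Fin 3, LinearMap.mulLeft ℂ (∑ j : Fin 3, C (A i j : ℂ) * X j : Poly) ∘ₗ
    ((pderiv i : Derivation ℂ Poly Poly) : Poly →ₗ[ℂ] Poly)

theorem vectorField_apply (A : Matrix (Fin 3) (Fin 3) ℝ) (p : Poly) :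
    vectorField A p = -∑ i : Fin 3, (∑ j : Fin 3, C (A i j : ℂ) * X j) * pderiv i p := by
  simp [vectorField]

theorem pderiv_comm' (i j : Fin 3) (p : Poly) :
    pderiv i (pderiv j p) = pderiv j (pderiv i p) := by
  have h : ⁅(pderiv i : Derivation ℂ Poly Poly), (pderiv j : Derivation ℂ Poly Poly)⁆ = 0 := by
    apply MvPolynomial.derivation_ext
    intro n
    rw [Derivation.commutator_apply, pderiv_X, pderiv_X, Pi.single_apply, Pi.single_apply]
    split_ifs <;> simp
  have := DFunLike.congr_fun h p
  rw [Derivation.commutator_apply] at this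
  simpa [sub_eq_zero] using this

theorem vectorField_mem_harmonic {A : Matrix (Fin 3) (Fin 3) ℝ} (hA : A.transpose = -A) {n : ℕ}
    {p : Poly} (hp : p ∈ harmonic n) : vectorField A p ∈ harmonic n := by
  obtain ⟨h1, h2⟩ := hp
  have h1' : p.IsHomogeneous n := h1
  have h2' : ∑ i : Fin 3, pderiv i (pderiv i p) = 0 := by
    rw [← laplacian_apply]; exact h2
  refine ⟨?_, ?_⟩
  · rw [vectorField_apply]
    refine Submodule.neg_mem _ (Submodule.sum_mem _ fun i _ => ?_)
    rw [mem_homogeneousSubmodule]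
    rcases n with _ | n
    · have : pderiv i p = 0 := by
        rw [totalDegree_eq_zero_iff_eq_C.1 (Nat.le_zero.1 h1'.totalDegree_le), pderiv_C]
      rw [this, mul_zero]
      exact isHomogeneous_zero _ _ _
    · have hl : (∑ j : Fin 3, C (A i j : ℂ) * X j : Poly).IsHomogeneous 1 :=
        IsHomogeneous.sum _ _ _ fun j _ => isHomogeneous_C_mul_X _ _
      have hd : (pderiv i p).IsHomogeneous n := h1'.pderiv
      rw [add_comm]
      exact hl.mul hd
  · change laplacian (vectorField A p) = 0
    have hs : ∀ i j : Fin 3, A j i = -A i j := fun i j => congrFun (congrFun hA i) j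
    have hX : ∀ (j : Fin 3) (q : Poly),
        laplacian (X j * q) = 2 * pderiv j q + X j * laplacian q := by
      intro j q
      have hl : ∀ i : Fin 3, pderiv i (pderiv i (X j * q)) =
          2 * (pderiv i (X j) * pderiv i q) + X j * pderiv i (pderiv i q) := by
        intro i
        have h1 : pderiv i (X j * q) = X j * pderiv i q + q * pderiv i (X j) :=
          Derivation.leibniz _ _ _
        have h2 : pderiv i (X j * pderiv i q) =
            X j * pderiv i (pderiv i q) + pderiv i q * pderiv i (X j) :=
          Derivation.leibniz _ _ _
        have h3 : pderiv i (q * pderiv i (X j)) =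
            q * pderiv i (pderiv i (X j)) + pderiv i (X j) * pderiv i q :=
          Derivation.leibniz _ _ _
        have h4 : pderiv i (pderiv i (X j : Poly)) = 0 := by
          rw [pderiv_X, Pi.single_apply]
          split_ifs <;> simp
        rw [h1, map_add, h2, h3, h4]
        ring
      simp only [laplacian_apply, hl, Finset.sum_add_distrib, ← Finset.mul_sum]
      congr 2
      rw [Finset.sum_eq_single j]
      · rw [pderiv_X_self, one_mul]
      · intro b _ hb
        rw [pderiv_X_of_ne hb.symm, zero_mul]
      · simp
    have hd : ∀ i : Fin 3, laplacian (pderiv i p) = 0 := by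
      intro i
      rw [laplacian_apply]
      calc ∑ l : Fin 3, pderiv l (pderiv l (pderiv i p))
          = pderiv i (∑ l : Fin 3, pderiv l (pderiv l p)) := by
            rw [map_sum]
            exact Finset.sum_congr rfl fun l _ => by
              rw [pderiv_comm' l i p, pderiv_comm' l i (pderiv l p)]
        _ = 0 := by rw [h2', map_zero]
    have hL : ∀ i : Fin 3, laplacian ((∑ j : Fin 3, C (A i j : ℂ) * X j) * pderiv i p) =
        ∑ j : Fin 3, C (A i j : ℂ) * (2 * pderiv j (pderiv i p)) := by
      intro i
      rw [Finset.sum_mul, map_sum]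
      refine Finset.sum_congr rfl fun j _ => ?_
      rw [mul_assoc, C_mul', map_smul, hX, hd, mul_zero, add_zero, C_mul']
    have h00 : A 0 0 = 0 := by linarith [hs 0 0]
    have h11 : A 1 1 = 0 := by linarith [hs 1 1]
    have h22 : A 2 2 = 0 := by linarith [hs 2 2]
    rw [vectorField_apply, map_neg, map_sum]
    simp only [hL]
    simp only [Fin.sum_univ_three, h00, h11, h22, hs 0 1, hs 0 2, hs 1 2, pderiv_comm' 1 0,
      pderiv_comm' 2 0, pderiv_comm' 2 1, Complex.ofReal_neg, Complex.ofReal_zero, C_neg, C_0]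
    ring

theorem vectorField_add (A B : Matrix (Fin 3) (Fin 3) ℝ) (p : Poly) :
    vectorField (A + B) p = vectorField A p + vectorField B p := by
  simp only [vectorField_apply, Fin.sum_univ_three, Matrix.add_apply, Complex.ofReal_add, C_add]
  ring

theorem vectorField_smul (c : ℝ) (A : Matrix (Fin 3) (Fin 3) ℝ) (p : Poly) :
    vectorField (c • A) p = (c : ℂ) • vectorField A p := by
  simp only [vectorField_apply, Fin.sum_univ_three, Matrix.smul_apply, smul_eq_mul,
    Complex.ofReal_mul, C_mul, smul_eq_C_mul]
  ring

/-- The derived representation `dτ_m` of `so(3)` on `H_m`. -/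
def dtau (m : ℕ) : LieSO3 →ₗ[ℝ] Module.End ℂ (harmonic m) where
  toFun Y := (vectorField (Y : Matrix (Fin 3) (Fin 3) ℝ)).restrict fun _ hp =>
    vectorField_mem_harmonic ((LieAlgebra.Orthogonal.mem_so (Fin 3) ℝ _).1 Y.2) hp
  map_add' Y Z := by
    exact LinearMap.ext fun p => Subtype.ext (vectorField_add _ _ _)
  map_smul' c Y := by
    exact LinearMap.ext fun p => Subtype.ext (vectorField_smul _ _ _)

theorem hasDerivAt_evalAt (c : ℝ → Fin 3 → ℝ) (v : Fin 3 → ℝ)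
    (hc : ∀ i, HasDerivAt (fun t => c t i) (v i) 0) (p : Poly) :
    HasDerivAt (fun t => evalAt (c t) p) (∑ i : Fin 3, (v i : ℂ) * evalAt (c 0) (pderiv i p)) 0 := by
  induction p using MvPolynomial.induction_on with
  | C a =>
    have h : ∀ t, evalAt (c t) (C a) = a := fun t => by simp [evalAt]
    simp only [h, pderiv_C, map_zero, mul_zero, Finset.sum_const_zero]
    exact hasDerivAt_const _ _
  | add p q hp hq =>
    simp only [map_add, mul_add, Finset.sum_add_distrib]
    exact hp.add hq
  | mul_X p n hp =>
    have hX : ∀ t, evalAt (c t) (X n) = (c t n : ℂ) := fun t => by simp [evalAt]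
    have hl : ∀ j : Fin 3, pderiv j (p * X n) = p * pderiv j (X n) + X n * pderiv j p :=
      fun j => Derivation.leibniz _ _ _
    have hd : ∀ j : Fin 3, evalAt (c 0) (pderiv j (X n)) = if j = n then 1 else 0 := by
      intro j
      rw [pderiv_X, Pi.single_apply]
      by_cases h : j = n
      · simp [h]
      · simp [h, Ne.symm h]
    have h := hp.mul (hc n).ofReal_comp
    simp only [map_mul, hX]
    refine h.congr_deriv ?_
    simp only [hl, map_add, map_mul, hd, hX, mul_add, Finset.sum_add_distrib, mul_ite, mul_one,
      mul_zero, Finset.sum_ite_eq', Finset.mem_univ, if_true, Finset.sum_mul]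
    rw [add_comm, mul_comm]
    exact congrArg _ (Finset.sum_congr rfl fun j _ => by ring)

theorem SO3.inv_apply (k : SO3) (i j : Fin 3) :
    ((k⁻¹ : SO3) : Matrix (Fin 3) (Fin 3) ℝ) i j = (k : Matrix (Fin 3) (Fin 3) ℝ) j i := rfl

/-- `dτ_m(Y)` is the derivative of `τ_m` at the identity in the direction `Y`: it is the derivative
at `t = 0` of `τ_m(k(t))` for every curve `k` in `SO(3)` with `k(0) = 1` and `k'(0) = Y`. -/
theorem hasDerivAt_tau (m : ℕ) (k : ℝ → SO3) (Y : LieSO3) (h0 : k 0 = 1)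
    (hk : ∀ i j, HasDerivAt (fun t => (k t : Matrix (Fin 3) (Fin 3) ℝ) i j)
      ((Y : Matrix (Fin 3) (Fin 3) ℝ) i j) 0) (p : harmonic m) (x : Fin 3 → ℝ) :
    HasDerivAt (fun t => evalAt x (tau m (k t) p : Poly)) (evalAt x (dtau m Y p : Poly)) 0 := by
  have hY : ∀ i j, (Y : Matrix (Fin 3) (Fin 3) ℝ) j i = -(Y : Matrix (Fin 3) (Fin 3) ℝ) i j :=
    fun i j => congrFun (congrFun ((LieAlgebra.Orthogonal.mem_so (Fin 3) ℝ _).1 Y.2) i) j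
  have h := hasDerivAt_evalAt
    (fun t => (((k t)⁻¹ : SO3) : Matrix (Fin 3) (Fin 3) ℝ).mulVec x)
    (fun i => ∑ j : Fin 3, (Y : Matrix (Fin 3) (Fin 3) ℝ) j i * x j)
    (fun i => by
      simp only [Matrix.mulVec, dotProduct, SO3.inv_apply]
      exact HasDerivAt.fun_sum fun j _ => (hk j i).mul_const (x j)) (p : Poly)
  simp only [← evalAt_tau] at h
  refine h.congr_deriv ?_
  change _ = evalAt x (vectorField (Y : Matrix (Fin 3) (Fin 3) ℝ) (p : Poly))
  rw [vectorField_apply, map_neg, map_sum, ← Finset.sum_neg_distrib]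
  refine Finset.sum_congr rfl fun i _ => ?_
  rw [h0, inv_one]
  simp [evalAt, hY i, Finset.sum_neg_distrib]

/-- The canonical basis `Y₁, Y₂, Y₃` of `so(3)`. -/
def basisMatrix : Fin 3 → Matrix (Fin 3) (Fin 3) ℝ :=
  ![!![0, 0, 0; 0, 0, 1; 0, -1, 0], !![0, 0, -1; 0, 0, 0; 1, 0, 0], !![0, 1, 0; -1, 0, 0; 0, 0, 0]]

/-- The canonical basis of `so(3)`, as elements of the Lie algebra. -/
def basisY (i : Fin 3) : LieSO3 :=
  ⟨basisMatrix i, by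
    rw [LieAlgebra.Orthogonal.mem_so]
    fin_cases i <;> ext a b <;> fin_cases a <;> fin_cases b <;> simp [basisMatrix]⟩

/-! ### `End(V_τ)`-valued polynomials on `ℝ³` -/

/-- `End(V)`-valued polynomials on `ℝ³`, with `V = H_m`: the algebra `𝒫(ℝ³) ⊗ End(V)`, where
`p ⊗ A` is the function `x ↦ p(x) A`, and products are pointwise. -/
abbrev EndPoly (m : ℕ) : Type := Poly ⊗[ℂ] Module.End ℂ (harmonic m)

/-- The value at `x ∈ ℝ³` of an `End(V)`-valued polynomial. -/
def EndPoly.evalAt {m : ℕ} (x : Fin 3 → ℝ) : EndPoly m →ₐ[ℂ] Module.End ℂ (harmonic m) :=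
  Algebra.TensorProduct.lift ((Algebra.ofId ℂ _).comp (EuclideanMotion.evalAt x))
    (AlgHom.id ℂ _) fun p A => by
      rw [AlgHom.comp_apply, Algebra.ofId_apply]
      exact Algebra.commute_algebraMap_left _ _

theorem EndPoly.evalAt_tmul {m : ℕ} (x : Fin 3 → ℝ) (p : Poly)
    (A : Module.End ℂ (harmonic m)) :
    EndPoly.evalAt x (p ⊗ₜ[ℂ] A) = EuclideanMotion.evalAt x p • A := by
  rw [EndPoly.evalAt, Algebra.TensorProduct.lift_tmul, AlgHom.comp_apply, Algebra.ofId_apply,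
    Algebra.smul_def]
  rfl

/-- The entry of an `End(V)`-valued polynomial picked out by a linear form on `End(V)`. -/
def EndPoly.entry {m : ℕ} (φ : Module.Dual ℂ (Module.End ℂ (harmonic m))) :
    EndPoly m →ₗ[ℂ] Poly :=
  (TensorProduct.rid ℂ Poly).toLinearMap ∘ₗ φ.lTensor Poly

theorem EndPoly.evalAt_smul {m : ℕ} (x : Fin 3 → ℝ) (p : Poly) (P : EndPoly m) :
    EndPoly.evalAt x (p • P) = EuclideanMotion.evalAt x p • EndPoly.evalAt x P := by
  have h : p • P = (p ⊗ₜ[ℂ] 1) * P := by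
    induction P using TensorProduct.induction_on with
    | zero => simp
    | tmul q A => simp [smul_tmul']
    | add P Q hP hQ => rw [smul_add, mul_add, hP, hQ]
  rw [h, map_mul, EndPoly.evalAt_tmul, smul_mul_assoc, one_mul]

theorem evalAt_rotate {p : Poly} (hp : p ∈ radialPoly) (k : SO3) (x : Fin 3 → ℝ) :
    evalAt ((k : Matrix (Fin 3) (Fin 3) ℝ).mulVec x) p = evalAt x p := by
  have hle : radialPoly ≤
      AlgHom.equalizer (evalAt ((k : Matrix (Fin 3) (Fin 3) ℝ).mulVec x)) (evalAt x) := by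
    refine Algebra.adjoin_le ?_
    rintro _ rfl
    have h1 : ∀ y : Fin 3 → ℝ, evalAt y normSqPoly = ((dotProduct y y : ℝ) : ℂ) := by
      intro y
      simp [evalAt, normSqPoly, dotProduct, pow_two]
    change evalAt _ normSqPoly = evalAt _ normSqPoly
    rw [h1, h1, Matrix.dotProduct_mulVec, ← Matrix.mulVec_transpose, Matrix.mulVec_mulVec,
      mul_eq_one_comm.1 (SO3.mul_transpose k), Matrix.one_mulVec]
  exact hle hp

/-- The `ℂ[|x|²]`-module `𝒫_τ`, `τ = τ_m`, of the `End(V_τ)`-valued polynomials with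
`P(k x) = τ(k) P(x) τ(k)⁻¹` for all `k ∈ SO(3)` and `x ∈ ℝ³`. -/
def equivariantPoly (m : ℕ) : Submodule radialPoly (EndPoly m) where
  carrier := {P | ∀ (k : SO3) (x : Fin 3 → ℝ),
    EndPoly.evalAt ((k : Matrix (Fin 3) (Fin 3) ℝ).mulVec x) P =
      tau m k * EndPoly.evalAt x P * tau m k⁻¹}
  zero_mem' k x := by simp
  add_mem' hP hQ k x := by simp [hP k x, hQ k x, mul_add, add_mul]
  smul_mem' c P hP k x := by
    change EndPoly.evalAt _ ((c : Poly) • P) = _ * EndPoly.evalAt _ ((c : Poly) • P) * _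
    rw [EndPoly.evalAt_smul, EndPoly.evalAt_smul, evalAt_rotate c.2, hP k x, mul_smul_comm,
      smul_mul_assoc]

/-- The harmonic homogeneous elements of degree `j` of `𝒫_τ`: those all of whose entries lie in
`H_j`. -/
def harmonicEquivariant (m j : ℕ) : Submodule ℂ (EndPoly m) :=
  (equivariantPoly m).restrictScalars ℂ ⊓
    ⨅ φ : Module.Dual ℂ (Module.End ℂ (harmonic m)), (harmonic j).comap (EndPoly.entry φ)

/-- `Q₁(x) = dτ_m(x) = ∑ᵢ xᵢ dτ_m(Yᵢ)`. -/
def Q1 (m : ℕ) : EndPoly m := ∑ i : Fin 3, (X i : Poly) ⊗ₜ[ℂ] dtau m (basisY i)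

/-- The differential operator `D_τ = ∑ᵢ ∂ᵢ dτ_m(Yᵢ)` on `End(V_τ)`-valued polynomials. -/
def Dtau (m : ℕ) : EndPoly m →ₗ[ℂ] EndPoly m :=
  ∑ i : Fin 3, TensorProduct.map ((pderiv i : Derivation ℂ Poly Poly) : Poly →ₗ[ℂ] Poly)
    (LinearMap.mulLeft ℂ (dtau m (basisY i)))

/-- The scalars `a_j = j² / (2j-1) · (c + (j²-1)/4)`, where `c = -m(m+1)` is the Casimir scalar
of `dτ_m`. -/
def coeffA (m j : ℕ) : ℂ :=
  (j : ℂ) ^ 2 / (2 * j - 1) * (-((m : ℂ) * (m + 1)) + ((j : ℂ) ^ 2 - 1) / 4)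

end EuclideanMotion

end

open EuclideanMotion

noncomputable section

namespace EuclideanMotion

/-! ### The rotational vector fields on scalar polynomials -/

/-! Write `Yₗ` for `dτ(Yₗ)` and `c = -m(m+1)`. Infinitesimal equivariance turns the rotational
vector field `Lₗ` into the commutator `P ↦ P Yₗ - Yₗ P`. Since `∑ Lₗ²` is `-j(j+1)` on `H_j`, an
invariant harmonic `P` of degree `j` satisfies `∑ Yₗ P Yₗ = (c + j(j+1)/2) P`. Together with `D(Q₁P)
= Q₁ D P + ∑ Yₗ P Yₗ` and the effect of `D` and `Δ` on `Q₁P` and `|x|²P`, this proves by one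
induction that the `Q_j` defined by the recursion are harmonic and that `D Q_j = a_j Q_{j-1}`
(`harmonicQ_spec`).

Generation rests on two evaluations. On the third axis, which meets every `SO(3)`-orbit, an
equivariant `P` commutes with the rotations fixing the axis. These have simple spectrum on `H_m`, so
`P(0,0,r)` is a polynomial of degree at most `2m` in `Y₃`, and a half turn reversing the axis fixes
the parity in `r` of its coefficients. Hence `|x|^{2m} P` is a radial combination of the `Q₁^j`
(`normSqPoly_pow_smul_mem_span`). At the isotropic point `(1,-i,0)`, `|x|²` vanishes and `Q₁`
becomes the lowering operator `F`. Since `1, F, …, F^{2m}` are independent, a radial combination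
divisible by `|x|²` has all its coefficients divisible by `|x|²`, and the power of `|x|²` cancels
(`exists_eq_X_mul_of_normSqPoly_smul_eq`).

The same argument applies to the `Q_j`, which also become `F^j`; so they are nonzero and independent
over `ℂ[|x|²]`. Applying `Δ` and the Euler operator to `∑ p_i(|x|²) Q_i` then isolates its harmonic
part of degree `j`. -/

theorem vectorField_basisMatrix (l : Fin 3) (p : Poly) :
    vectorField (basisMatrix l) p =
      X (l + 1) * pderiv (l + 2) p - X (l + 2) * pderiv (l + 1) p := by
  rw [vectorField_apply]
  fin_cases l <;> simp [basisMatrix, Fin.sum_univ_three] <;> ring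

theorem vectorField_mul (A : Matrix (Fin 3) (Fin 3) ℝ) (p q : Poly) :
    vectorField A (p * q) = vectorField A p * q + p * vectorField A q := by
  simp only [vectorField_apply, pderiv_mul, Fin.sum_univ_three]
  ring

/-- With `E = ∑ xᵢ∂ᵢ`, one has `∑ Lₗ² = |x|²Δ - E² - E`. The second derivatives in `E²` come from
differentiating Euler's relation. -/
theorem sum_vectorField_vectorField {j : ℕ} {p : Poly} (hp : p ∈ harmonic j) :
    ∑ l : Fin 3, vectorField (basisMatrix l) (vectorField (basisMatrix l) p) =
      -((j : ℂ) * (j + 1)) • p := by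
  obtain ⟨h1, h2⟩ := hp
  have h1' : p.IsHomogeneous j := h1
  have h2' : laplacian p = 0 := h2
  have he := h1'.sum_X_mul_pderiv
  have hk : ∀ k, pderiv k (∑ i, X i * pderiv i p) = pderiv k (j • p) := fun k => by rw [he]
  rw [laplacian_apply] at h2'
  have hk0 := hk 0
  have hk1 := hk 1
  have hk2 := hk 2
  simp only [Fin.sum_univ_three, map_add, pderiv_mul, pderiv_X, Pi.single_apply, map_nsmul]
    at he h2' hk0 hk1 hk2
  simp only [Fin.sum_univ_three, vectorField_basisMatrix, pderiv_mul, pderiv_X, Pi.single_apply,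
    map_sub, pderiv_comm' 1 0, pderiv_comm' 2 0, pderiv_comm' 2 1, Fin.isValue, zero_add,
    Fin.reduceAdd, Fin.reduceEq, if_true, if_false, nsmul_eq_mul, smul_eq_C_mul, map_neg, map_mul,
    map_natCast, map_one, map_add] at he h2' hk0 hk1 hk2 ⊢
  linear_combination (X 0 ^ 2 + X 1 ^ 2 + X 2 ^ 2) * h2' - X 0 * hk0 - X 1 * hk1 - X 2 * hk2 -
    (j + 1 : Poly) * he

/-! ### Identities in noncommutative algebras -/

theorem sum_fin_three_add {M : Type*} [AddCommMonoid M] (f : Fin 3 → M) (l : Fin 3) :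
    ∑ i, f i = f l + f (l + 1) + f (l + 2) := by
  rw [Fin.sum_univ_three]
  fin_cases l <;> simp <;> abel

theorem commutator_leibniz {R : Type*} [Ring R] (P Q g : R) :
    (P * g - g * P) * Q + P * (Q * g - g * Q) = P * Q * g - g * (P * Q) := by
  noncomm_ring

theorem commutator_commutator {R : Type*} [Ring R] [Algebra ℂ R] (P g : R) :
    (P * g - g * P) * g - g * (P * g - g * P) =
      P * (g * g) + g * g * P - (2 : ℂ) • (g * P * g) := by
  rw [two_smul]
  noncomm_ring

theorem eq_smul_of_smul_add_sub {M : Type*} [AddCommGroup M] [Module ℂ M] {a b : ℂ} {P S : M}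
    (h : a • P + a • P - (2 : ℂ) • S = -b • P) : S = (a + b / 2) • P := by
  have h1 : (2 : ℂ) • S = (2 : ℂ) • (a + b / 2) • P := by
    have : (2 : ℂ) • S = a • P + a • P - -b • P := by rw [← h]; abel
    rw [this]
    module
  exact smul_right_injective _ (two_ne_zero' ℂ) h1

theorem smul_commutator_identity {A M : Type*} [CommRing A] [AddCommGroup M] [Module A M]
    (a b : A) (u v p q r : M) :
    -a • u + b • v = (r + b • (p + v) + a • q) - (r + b • p + a • (q + u)) := by
  module

/-- The algebra behind `Dtau_Q1_mul`, with `dᵢ = ∂ᵢP`. Exchanging `gᵢ` and `gₖ` in `xₖ gᵢ gₖ dᵢ`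
leaves `∑ gₗ (P gₗ - gₗ P)` by the bracket relations and `r₀`, `r₁`, `r₂`; this replaces `∑ gₗ gₗ P`
by `∑ gₗ P gₗ`. -/
theorem sum_mul_commutator {A R : Type*} [CommRing A] [Ring R] [Algebra A R] (x₀ x₁ x₂ : A)
    {g₀ g₁ g₂ P d₀ d₁ d₂ : R} (h₀ : g₁ * g₀ = g₀ * g₁ + g₂) (h₁ : g₂ * g₁ = g₁ * g₂ + g₀)
    (h₂ : g₀ * g₂ = g₂ * g₀ + g₁) (r₀ : x₁ • d₂ - x₂ • d₁ = P * g₀ - g₀ * P)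
    (r₁ : x₂ • d₀ - x₀ • d₂ = P * g₁ - g₁ * P) (r₂ : x₀ • d₁ - x₁ • d₀ = P * g₂ - g₂ * P) :
    g₀ * (g₀ * P + x₀ • (g₀ * d₀) + x₁ • (g₁ * d₀) + x₂ • (g₂ * d₀)) +
    g₁ * (g₁ * P + x₀ • (g₀ * d₁) + x₁ • (g₁ * d₁) + x₂ • (g₂ * d₁)) +
    g₂ * (g₂ * P + x₀ • (g₀ * d₂) + x₁ • (g₁ * d₂) + x₂ • (g₂ * d₂)) =
    x₀ • (g₀ * (g₀ * d₀ + g₁ * d₁ + g₂ * d₂)) + x₁ • (g₁ * (g₀ * d₀ + g₁ * d₁ + g₂ * d₂)) +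
    x₂ • (g₂ * (g₀ * d₀ + g₁ * d₁ + g₂ * d₂)) + (g₀ * P * g₀ + g₁ * P * g₁ + g₂ * P * g₂) := by
  have e₀ : P * g₀ = x₁ • d₂ - x₂ • d₁ + g₀ * P := by rw [r₀]; abel
  have e₁ : P * g₁ = x₂ • d₀ - x₀ • d₂ + g₁ * P := by rw [r₁]; abel
  have e₂ : P * g₂ = x₀ • d₁ - x₁ • d₀ + g₂ * P := by rw [r₂]; abel
  have k₀ : ∀ z, g₁ * (g₀ * z) = g₀ * (g₁ * z) + g₂ * z := fun z => by
    rw [← mul_assoc, h₀, add_mul, mul_assoc]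
  have k₁ : ∀ z, g₂ * (g₁ * z) = g₁ * (g₂ * z) + g₀ * z := fun z => by
    rw [← mul_assoc, h₁, add_mul, mul_assoc]
  have k₂ : ∀ z, g₀ * (g₂ * z) = g₂ * (g₀ * z) + g₁ * z := fun z => by
    rw [← mul_assoc, h₂, add_mul, mul_assoc]
  simp only [mul_assoc, e₀, e₁, e₂, mul_add, mul_sub, mul_smul_comm, k₀, k₁, k₂, smul_add]
  abel

/-! ### Calculus of `End(V)`-valued polynomials -/

namespace EndPoly

variable {m : ℕ}

/-- Entrywise application of a linear operator on scalar polynomials. -/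
def entrywise (T : Poly →ₗ[ℂ] Poly) : EndPoly m →ₗ[ℂ] EndPoly m :=
  T.rTensor (Module.End ℂ (harmonic m))

@[simp] theorem entrywise_tmul (T : Poly →ₗ[ℂ] Poly) (p : Poly)
    (A : Module.End ℂ (harmonic m)) : entrywise T (p ⊗ₜ[ℂ] A) = T p ⊗ₜ[ℂ] A := rfl

@[simp] theorem entry_tmul (φ : Module.Dual ℂ (Module.End ℂ (harmonic m))) (p : Poly)
    (A : Module.End ℂ (harmonic m)) : entry φ (p ⊗ₜ[ℂ] A) = φ A • p := rfl

/-- A constant `End(V)`-valued polynomial. -/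
def const : Module.End ℂ (harmonic m) →ₐ[ℂ] EndPoly m := Algebra.TensorProduct.includeRight

theorem const_apply (A : Module.End ℂ (harmonic m)) : const A = (1 : Poly) ⊗ₜ[ℂ] A := rfl

theorem entry_entrywise (φ : Module.Dual ℂ (Module.End ℂ (harmonic m))) (T : Poly →ₗ[ℂ] Poly)
    (P : EndPoly m) : entry φ (entrywise T P) = T (entry φ P) := by
  induction P using TensorProduct.induction_on with
  | zero => simp
  | tmul p A => simp
  | add P Q hP hQ => simp only [map_add, hP, hQ]

theorem entry_smul (φ : Module.Dual ℂ (Module.End ℂ (harmonic m))) (p : Poly)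
    (P : EndPoly m) : entry φ (p • P) = p * entry φ P := by
  induction P using TensorProduct.induction_on with
  | zero => simp
  | tmul q A => simp [smul_tmul']
  | add P Q hP hQ => simp only [map_add, smul_add, mul_add, hP, hQ]

theorem entry_const_mul (φ : Module.Dual ℂ (Module.End ℂ (harmonic m)))
    (A : Module.End ℂ (harmonic m)) (P : EndPoly m) :
    entry φ (const A * P) = entry (φ ∘ₗ LinearMap.mulLeft ℂ A) P := by
  induction P using TensorProduct.induction_on with
  | zero => simp
  | tmul q B => simp [const_apply]
  | add P Q hP hQ => simp only [map_add, mul_add, hP, hQ]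

theorem evalAt_entry (φ : Module.Dual ℂ (Module.End ℂ (harmonic m))) (x : Fin 3 → ℝ)
    (P : EndPoly m) :
    EuclideanMotion.evalAt x (entry φ P) = φ (EndPoly.evalAt x P) := by
  induction P using TensorProduct.induction_on with
  | zero => simp
  | tmul q A => simp [evalAt_tmul, mul_comm]
  | add P Q hP hQ => simp only [map_add, hP, hQ]

/-- The entries along the coordinate forms of a basis of `End(V)` are the coordinates of `P` over
`Poly`. Identities can therefore be checked on scalar polynomials. -/
theorem ext_entry {P Q : EndPoly m} (h : ∀ φ, entry φ P = entry φ Q) : P = Q := by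
  have : Module.Free ℂ (Module.End ℂ (harmonic m)) := by
    exact (Module.Free.of_divisionRing ℂ (Module.End ℂ (harmonic m)) :)
  let b := Module.Free.chooseBasis ℂ (Module.End ℂ (harmonic m))
  have hb : ∀ i (R : EndPoly m),
      (Algebra.TensorProduct.basis Poly b).repr R i = entry (b.coord i) R := by
    intro i R
    induction R using TensorProduct.induction_on with
    | zero => simp
    | tmul q A => simp [Algebra.TensorProduct.basis_repr_tmul, smul_eq_C_mul, mul_comm]
    | add P Q hP hQ => simp only [map_add, Finsupp.add_apply, hP, hQ]
  refine (Algebra.TensorProduct.basis Poly b).ext_elem fun i => ?_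
  rw [hb, hb, h]

/-- Real points suffice because `ℝ` is an infinite subset of `ℂ`, so `ℝ³` is Zariski dense in `ℂ³`.
-/
theorem ext_evalAt {P Q : EndPoly m} (h : ∀ x, EndPoly.evalAt x P = EndPoly.evalAt x Q) :
    P = Q := by
  refine ext_entry fun φ => ?_
  refine MvPolynomial.funext_set (fun _ => Set.range ((↑) : ℝ → ℂ))
    (fun _ => Set.infinite_range_of_injective Complex.ofReal_injective) fun y hy => ?_
  choose x hx using fun i => hy i (Set.mem_univ i)
  obtain rfl : (fun i => (x i : ℂ)) = y := funext hx
  have := congrArg φ (h x)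
  rwa [← evalAt_entry, ← evalAt_entry] at this

theorem eq_zero_of_smul_eq_zero {p : Poly} (hp : p ≠ 0) {P : EndPoly m} (h : p • P = 0) : P = 0 := by
  refine ext_entry fun φ => ?_
  have := congrArg (entry φ) h
  rw [entry_smul, map_zero] at this
  rw [map_zero]
  exact (mul_eq_zero.1 this).resolve_left hp

theorem entrywise_smul_of_leibniz {T : Poly →ₗ[ℂ] Poly}
    (hT : ∀ p q, T (p * q) = T p * q + p * T q) (p : Poly) (P : EndPoly m) :
    entrywise T (p • P) = T p • P + p • entrywise T P := by
  refine ext_entry fun φ => ?_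
  simp only [entry_entrywise, map_add, entry_smul, hT]

theorem entrywise_mul_of_leibniz {T : Poly →ₗ[ℂ] Poly}
    (hT : ∀ p q, T (p * q) = T p * q + p * T q) (P Q : EndPoly m) :
    entrywise T (P * Q) = entrywise T P * Q + P * entrywise T Q := by
  induction P using TensorProduct.induction_on with
  | zero => simp
  | tmul p A =>
    induction Q using TensorProduct.induction_on with
    | zero => simp
    | tmul q B => simp [hT, add_tmul]
    | add P Q hP hQ =>
      simp only [map_add, mul_add, hP, hQ]
      abel
  | add P Q hP hQ =>
    simp only [map_add, add_mul, hP, hQ]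
    abel

theorem entrywise_const_mul (T : Poly →ₗ[ℂ] Poly) (A : Module.End ℂ (harmonic m))
    (P : EndPoly m) : entrywise T (const A * P) = const A * entrywise T P := by
  induction P using TensorProduct.induction_on with
  | zero => simp
  | tmul q B => simp [const_apply]
  | add P Q hP hQ => simp only [map_add, mul_add, hP, hQ]

/-- The partial derivatives of an `End(V)`-valued polynomial. -/
def pd (i : Fin 3) : EndPoly m →ₗ[ℂ] EndPoly m :=
  entrywise ((pderiv i : Derivation ℂ Poly Poly) : Poly →ₗ[ℂ] Poly)

theorem pd_smul (i : Fin 3) (p : Poly) (P : EndPoly m) :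
    pd i (p • P) = pderiv i p • P + p • pd i P :=
  entrywise_smul_of_leibniz (fun _ _ => pderiv_mul) p P

theorem pd_const_mul (i : Fin 3) (A : Module.End ℂ (harmonic m)) (P : EndPoly m) :
    pd i (const A * P) = const A * pd i P :=
  entrywise_const_mul _ A P

/-- The infinitesimal generator `Yₗ` as a constant `End(V)`-valued polynomial. -/
abbrev gen (m : ℕ) (l : Fin 3) : EndPoly m := const (dtau m (basisY l))

theorem Q1_eq : Q1 m = ∑ i : Fin 3, (X i : Poly) • gen m i := by
  refine Finset.sum_congr rfl fun i _ => ?_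
  rw [gen, const_apply, smul_tmul', smul_eq_mul, mul_one]

theorem Q1_mul (P : EndPoly m) : Q1 m * P = ∑ i : Fin 3, (X i : Poly) • (gen m i * P) := by
  rw [Q1_eq, Finset.sum_mul]
  simp only [smul_mul_assoc]

theorem Dtau_apply (P : EndPoly m) : Dtau m P = ∑ i : Fin 3, gen m i * pd i P := by
  induction P using TensorProduct.induction_on with
  | zero => simp
  | tmul q B => simp [Dtau, pd, const_apply]
  | add P Q hP hQ => simp only [map_add, mul_add, hP, hQ, Finset.sum_add_distrib]

/-! ### Commutation relations, the Casimir operator and infinitesimal invariance. -/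

theorem dtau_mul (l : Fin 3) : dtau m (basisY (l + 1)) * dtau m (basisY l) =
    dtau m (basisY l) * dtau m (basisY (l + 1)) + dtau m (basisY (l + 2)) := by
  refine LinearMap.ext fun p => Subtype.ext ?_
  change vectorField (basisMatrix (l + 1)) (vectorField (basisMatrix l) (p : Poly)) =
    vectorField (basisMatrix l) (vectorField (basisMatrix (l + 1)) (p : Poly)) +
      vectorField (basisMatrix (l + 2)) (p : Poly)
  simp only [vectorField_basisMatrix]
  fin_cases l <;>
  simp [pderiv_X, pderiv_comm' 1 0, pderiv_comm' 2 0, pderiv_comm' 2 1] <;> ring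

theorem sum_dtau_sq :
    ∑ l : Fin 3, dtau m (basisY l) * dtau m (basisY l) = -((m : ℂ) * (m + 1)) • 1 := by
  refine LinearMap.ext fun p => Subtype.ext ?_
  have h := sum_vectorField_vectorField p.2
  rw [LinearMap.sum_apply, AddSubmonoidClass.coe_finsetSum]
  exact h

theorem gen_mul_gen (l : Fin 3) :
    gen m (l + 1) * gen m l = gen m l * gen m (l + 1) + gen m (l + 2) := by
  simp only [gen, ← map_mul, ← map_add, dtau_mul]

theorem sum_gen_sq : ∑ l : Fin 3, gen m l * gen m l = -((m : ℂ) * (m + 1)) • 1 := by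
  simp only [gen, ← map_mul, ← map_sum, sum_dtau_sq, map_smul, map_one]

/-- Infinitesimal equivariance under `so(3)`. -/
def IsInvariant (P : EndPoly m) : Prop :=
  ∀ l : Fin 3, entrywise (vectorField (basisMatrix l)) P = P * gen m l - gen m l * P

theorem IsInvariant.mul {P Q : EndPoly m} (hP : IsInvariant P) (hQ : IsInvariant Q) :
    IsInvariant (P * Q) := fun l => by
  rw [entrywise_mul_of_leibniz (vectorField_mul _), hP, hQ]
  exact commutator_leibniz _ _ _

theorem IsInvariant.sub {P Q : EndPoly m} (hP : IsInvariant P) (hQ : IsInvariant Q) :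
    IsInvariant (P - Q) := fun l => by
  rw [map_sub, hP, hQ, sub_mul, mul_sub]
  exact sub_sub_sub_comm _ _ _ _

theorem IsInvariant.smul {P : EndPoly m} (hP : IsInvariant P) (c : ℂ) :
    IsInvariant (c • P) := fun l => by
  rw [map_smul, hP, smul_mul_assoc, mul_smul_comm, smul_sub]

theorem IsInvariant.normSqPoly_smul {P : EndPoly m} (hP : IsInvariant P) :
    IsInvariant (normSqPoly • P) := fun l => by
  have h0 : vectorField (basisMatrix l) normSqPoly = 0 := by
    rw [vectorField_basisMatrix, normSqPoly]
    fin_cases l <;> simp [Fin.sum_univ_three, pderiv_X] <;> ring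
  rw [entrywise_smul_of_leibniz (vectorField_mul _), hP, h0, zero_smul, zero_add, smul_mul_assoc,
    mul_smul_comm, smul_sub]

theorem isInvariant_one : IsInvariant (1 : EndPoly m) := fun l => by
  have : (1 : EndPoly m) = 1 ⊗ₜ[ℂ] 1 := rfl
  rw [mul_one, one_mul, sub_self, this, entrywise_tmul, vectorField_basisMatrix]
  simp

theorem isInvariant_Q1 : IsInvariant (Q1 m) := fun l => by
  have hc : ∀ i, entrywise (vectorField (basisMatrix l)) (gen m i) = 0 := fun i => by
    rw [gen, const_apply, entrywise_tmul, vectorField_basisMatrix]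
    simp
  have h1 := gen_mul_gen (m := m) l
  have h2 : gen m l * gen m (l + 2) = gen m (l + 2) * gen m l + gen m (l + 1) := by
    have := gen_mul_gen (m := m) (l + 2)
    have e : l + 2 + 1 = l := by fin_cases l <;> rfl
    have e' : l + 2 + 2 = l + 1 := by fin_cases l <;> rfl
    rwa [e, e'] at this
  have hX : ∀ i : Fin 3, entrywise (vectorField (basisMatrix l)) ((X i : Poly) • gen m i) =
      vectorField (basisMatrix l) (X i) • gen m i := fun i => by
    rw [entrywise_smul_of_leibniz (vectorField_mul _), hc, smul_zero, add_zero]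
  have v0 : vectorField (basisMatrix l) (X l) = 0 := by
    rw [vectorField_basisMatrix]
    fin_cases l <;> simp [pderiv_X]
  have v1 : vectorField (basisMatrix l) (X (l + 1)) = -X (l + 2) := by
    rw [vectorField_basisMatrix]
    fin_cases l <;> simp [pderiv_X]
  have v2 : vectorField (basisMatrix l) (X (l + 2)) = X (l + 1) := by
    rw [vectorField_basisMatrix]
    fin_cases l <;> simp [pderiv_X]
  rw [Q1_eq, sum_fin_three_add _ l]
  simp only [map_add, add_mul, mul_add, smul_mul_assoc, mul_smul_comm, hX, v0, v1, v2, h1, h2,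
    zero_smul, zero_add]
  exact smul_commutator_identity (A := Poly) (M := EndPoly m) (X (l + 2)) (X (l + 1))
    (gen m (l + 1)) (gen m (l + 2)) _ _ _

/-! ### Harmonicity -/

theorem entrywise_laplacian (P : EndPoly m) :
    entrywise laplacian P = ∑ i : Fin 3, pd i (pd i P) := by
  refine ext_entry fun φ => ?_
  simp only [map_sum, pd, entry_entrywise, laplacian_apply]
  rfl

/-- The `End(V)`-valued polynomials whose entries are harmonic homogeneous of degree `j`. -/
def IsHarmonic (j : ℕ) (P : EndPoly m) : Prop := ∀ φ, entry φ P ∈ harmonic j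

theorem IsHarmonic.laplacian_eq_zero {j : ℕ} {P : EndPoly m} (hP : IsHarmonic j P) :
    entrywise laplacian P = 0 := by
  refine ext_entry fun φ => ?_
  rw [entry_entrywise, map_zero]
  exact (hP φ).2

theorem IsHarmonic.euler {j : ℕ} {P : EndPoly m} (hP : IsHarmonic j P) :
    ∑ i : Fin 3, (X i : Poly) • pd i P = (j : ℂ) • P := by
  refine ext_entry fun φ => ?_
  have h : (entry φ P).IsHomogeneous j := (hP φ).1
  have := h.sum_X_mul_pderiv
  simp only [map_sum, entry_smul, pd, entry_entrywise, map_smul]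
  refine this.trans ?_
  rw [nsmul_eq_mul, smul_eq_C_mul, map_natCast]

/-- By invariance `Lₗ²P` is the double commutator `P Yₗ² + Yₗ² P - 2 Yₗ P Yₗ`. Summing over `l`
gives `2cP - 2 ∑ Yₗ P Yₗ`, while harmonicity gives `-j(j+1)P`. -/
theorem IsHarmonic.sum_gen_mul_mul_gen {j : ℕ} {P : EndPoly m} (hP : IsHarmonic j P)
    (hI : IsInvariant P) : ∑ l : Fin 3, gen m l * P * gen m l =
      (-((m : ℂ) * (m + 1)) + (j : ℂ) * (j + 1) / 2) • P := by
  have h1 : ∑ l : Fin 3, entrywise (vectorField (basisMatrix l))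
      (entrywise (vectorField (basisMatrix l)) P) = -((j : ℂ) * (j + 1)) • P := by
    refine ext_entry fun φ => ?_
    simp only [map_sum, entry_entrywise, map_smul]
    exact sum_vectorField_vectorField (hP φ)
  have h2 : ∀ l, entrywise (vectorField (basisMatrix l))
      (entrywise (vectorField (basisMatrix l)) P) =
      P * (gen m l * gen m l) + (gen m l * gen m l) * P - (2 : ℂ) • (gen m l * P * gen m l) := by
    intro l
    have hr : entrywise (vectorField (basisMatrix l)) (P * gen m l) =
        entrywise (vectorField (basisMatrix l)) P * gen m l := by
      rw [entrywise_mul_of_leibniz (vectorField_mul _), gen, const_apply, entrywise_tmul,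
        vectorField_basisMatrix]
      simp
    rw [hI l, map_sub, hr, entrywise_const_mul, hI l]
    exact commutator_commutator _ _
  simp only [h2, Finset.sum_sub_distrib, Finset.sum_add_distrib, ← Finset.mul_sum,
    ← Finset.sum_mul, ← Finset.smul_sum, sum_gen_sq] at h1
  rw [mul_smul_comm, mul_one, smul_mul_assoc, one_mul] at h1
  exact eq_smul_of_smul_add_sub h1

theorem IsInvariant.rotation {P : EndPoly m} (hI : IsInvariant P) (l : Fin 3) :
    (X (l + 1) : Poly) • pd (l + 2) P - (X (l + 2) : Poly) • pd (l + 1) P =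
      P * gen m l - gen m l * P := by
  rw [← hI l]
  refine ext_entry fun φ => ?_
  simp only [map_sub, entry_smul, pd, entry_entrywise, vectorField_basisMatrix]
  rfl

theorem pd_Q1_mul (i : Fin 3) (P : EndPoly m) :
    pd i (Q1 m * P) = gen m i * P + (X 0 : Poly) • (gen m 0 * pd i P) +
      (X 1 : Poly) • (gen m 1 * pd i P) + (X 2 : Poly) • (gen m 2 * pd i P) := by
  rw [Q1_mul, map_sum]
  simp only [pd_smul, pd_const_mul, Finset.sum_add_distrib]
  rw [Finset.sum_eq_single i (fun b _ hb => by rw [pderiv_X_of_ne hb, zero_smul]) (by simp),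
    pderiv_X_self, one_smul, Fin.sum_univ_three]
  simp only [add_assoc]

theorem Dtau_Q1_mul {P : EndPoly m} (hI : IsInvariant P) :
    Dtau m (Q1 m * P) = Q1 m * Dtau m P + ∑ l : Fin 3, gen m l * P * gen m l := by
  rw [Dtau_apply (Q1 m * P), Q1_mul (Dtau m P), Dtau_apply P]
  simp only [pd_Q1_mul]
  simp only [Fin.sum_univ_three]
  exact sum_mul_commutator (A := Poly) _ _ _ (gen_mul_gen 0) (gen_mul_gen 1) (gen_mul_gen 2)
    (hI.rotation 0) (hI.rotation 1) (hI.rotation 2)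

/-! ### The harmonic polynomials `Q_j` -/

/-- The sequence `Q₀ = 1`, `Q₁`, `Q_{j+1} = Q₁ Q_j - a_j / (2j+1) |x|² Q_{j-1}`. -/
def harmonicQ (m : ℕ) : ℕ → EndPoly m
  | 0 => 1
  | 1 => Q1 m
  | j + 2 => Q1 m * harmonicQ m (j + 1) -
      (coeffA m (j + 1) / (2 * ((j + 1 : ℕ) : ℂ) + 1)) • normSqPoly • harmonicQ m j

theorem coeffA_zero : coeffA m 0 = 0 := by simp [coeffA]

/-- This is the recursion that `D` imposes on the scalars; with `a₀ = 0` it determines the closed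
form. -/
theorem coeffA_succ (j : ℕ) : coeffA m (j + 1) = coeffA m j * (2 * j - 1) / (2 * j + 1) +
    (-((m : ℂ) * (m + 1)) + (j : ℂ) * (j + 1) / 2) := by
  have h1 : (2 * (j : ℂ) + 1) ≠ 0 := by exact_mod_cast (by omega : 2 * j + 1 ≠ 0)
  -- An odd integer is nonzero, also at `j = 0`, where it is `-1`; hence the detour through `ℤ`.
  have h2 : (2 * (j : ℂ) - 1) ≠ 0 := by
    have : (2 * (j : ℤ) - 1) ≠ 0 := by omega
    exact_mod_cast this
  have h3 : 2 * ((j : ℂ) + 1) - 1 = 2 * j + 1 := by ring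
  simp only [coeffA, Nat.cast_add, Nat.cast_one, h3]
  generalize (j : ℂ) = x at *
  have h4 : x ^ 2 / (2 * x - 1) * (-((m : ℂ) * (m + 1)) + (x ^ 2 - 1) / 4) * (2 * x - 1) =
      x ^ 2 * (-((m : ℂ) * (m + 1)) + (x ^ 2 - 1) / 4) := by
    rw [div_mul_eq_mul_div, div_mul_cancel₀ _ h2]
  rw [h4, div_mul_eq_mul_div, div_add' _ _ _ h1]
  congr 1
  ring

/-- At `j = 0` the index `j - 1` truncates to `0`, which is harmless because `a₀ = 0`. -/
theorem harmonicQ_succ (j : ℕ) : harmonicQ m (j + 1) = Q1 m * harmonicQ m j -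
    (coeffA m j / (2 * j + 1)) • normSqPoly • harmonicQ m (j - 1) := by
  cases j with
  | zero => rw [coeffA_zero, zero_div, zero_smul, sub_zero, harmonicQ, harmonicQ, mul_one]
  | succ j => rw [harmonicQ, Nat.add_sub_cancel]

theorem Q1_mul_harmonicQ (j : ℕ) : Q1 m * harmonicQ m j = harmonicQ m (j + 1) +
    (coeffA m j / (2 * j + 1)) • normSqPoly • harmonicQ m (j - 1) := by
  rw [harmonicQ_succ]
  exact (sub_add_cancel _ _).symm

theorem isInvariant_harmonicQ (j : ℕ) : IsInvariant (harmonicQ m j) := by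
  induction j using Nat.twoStepInduction with
  | zero => exact isInvariant_one
  | one => exact isInvariant_Q1
  | more j h0 h1 =>
    exact (isInvariant_Q1.mul h1).sub (h0.normSqPoly_smul.smul _)

/-- All entries are homogeneous of degree `j`. -/
def IsHomogeneous (j : ℕ) (P : EndPoly m) : Prop := ∀ φ, (entry φ P).IsHomogeneous j

theorem IsHomogeneous.Q1_mul {j : ℕ} {P : EndPoly m} (hP : IsHomogeneous j P) :
    IsHomogeneous (j + 1) (Q1 m * P) := fun φ => by
  rw [EndPoly.Q1_mul, map_sum]
  refine MvPolynomial.IsHomogeneous.sum _ _ _ fun i _ => ?_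
  rw [entry_smul, entry_const_mul, add_comm]
  exact (isHomogeneous_X _ _).mul (hP _)

theorem normSqPoly_isHomogeneous : normSqPoly.IsHomogeneous 2 :=
  MvPolynomial.IsHomogeneous.sum _ _ _ fun _ _ => isHomogeneous_X_pow _ _

theorem IsHomogeneous.normSqPoly_smul {j : ℕ} {P : EndPoly m} (hP : IsHomogeneous j P) :
    IsHomogeneous (j + 2) (normSqPoly • P) := fun φ => by
  rw [entry_smul, add_comm]
  exact normSqPoly_isHomogeneous.mul (hP φ)

theorem IsHomogeneous.smul {j : ℕ} {P : EndPoly m} (hP : IsHomogeneous j P) (c : ℂ) :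
    IsHomogeneous j (c • P) := fun φ => by
  rw [map_smul]
  exact Submodule.smul_mem (homogeneousSubmodule (Fin 3) ℂ j) c (hP φ)

theorem IsHomogeneous.sub {j : ℕ} {P Q : EndPoly m} (hP : IsHomogeneous j P)
    (hQ : IsHomogeneous j Q) : IsHomogeneous j (P - Q) := fun φ => by
  rw [map_sub]
  exact (hP φ).sub (hQ φ)

theorem isHomogeneous_one : IsHomogeneous 0 (1 : EndPoly m) := fun φ => by
  have : (1 : EndPoly m) = 1 ⊗ₜ[ℂ] 1 := rfl
  rw [this, entry_tmul]
  exact Submodule.smul_mem (homogeneousSubmodule (Fin 3) ℂ 0) _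
    (MvPolynomial.isHomogeneous_one _ _)

theorem isHarmonic_iff {j : ℕ} {P : EndPoly m} :
    IsHarmonic j P ↔ IsHomogeneous j P ∧ entrywise laplacian P = 0 := by
  refine ⟨fun h => ⟨fun φ => (h φ).1, h.laplacian_eq_zero⟩, fun h φ => ⟨h.1 φ, ?_⟩⟩
  change laplacian (entry φ P) = 0
  rw [← entry_entrywise, h.2, map_zero]

/-! ### The operators `D_τ` and `Δ` on products with `Q₁` and `|x|²`. -/

theorem pderiv_normSqPoly (i : Fin 3) : pderiv i normSqPoly = 2 * X i := by
  rw [normSqPoly, Fin.sum_univ_three]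
  fin_cases i <;> simp [pderiv_X]

theorem pd_normSqPoly_smul (i : Fin 3) (P : EndPoly m) :
    pd i (normSqPoly • P) = (2 * X i : Poly) • P + normSqPoly • pd i P := by
  rw [pd_smul, pderiv_normSqPoly]

theorem Dtau_normSqPoly_smul (P : EndPoly m) :
    Dtau m (normSqPoly • P) = (2 : ℂ) • (Q1 m * P) + normSqPoly • Dtau m P := by
  simp only [Dtau_apply, pd_normSqPoly_smul, mul_add, Finset.sum_add_distrib, mul_smul_comm,
    Finset.smul_sum, Q1_mul]
  congr 1
  refine Finset.sum_congr rfl fun i _ => ?_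
  rw [two_smul, two_mul, add_smul]

theorem laplacian_Q1_mul (P : EndPoly m) :
    entrywise laplacian (Q1 m * P) = (2 : ℂ) • Dtau m P + Q1 m * entrywise laplacian P := by
  have h : ∀ i (p : Poly), laplacian (X i * p) = (2 : ℂ) • pderiv i p + X i * laplacian p := by
    intro i p
    simp only [laplacian_apply, Fin.sum_univ_three, pderiv_mul, map_add, smul_eq_C_mul, map_ofNat]
    fin_cases i <;> simp [pderiv_X] <;> ring
  have h' : ∀ i (P : EndPoly m), entrywise laplacian ((X i : Poly) • P) =
      (2 : ℂ) • pd i P + (X i : Poly) • entrywise laplacian P := by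
    intro i P
    refine ext_entry fun φ => ?_
    simp only [map_add, map_smul, entry_smul, entry_entrywise, pd, h]
    rfl
  simp only [Q1_mul, map_sum, h', entrywise_const_mul, Dtau_apply, Finset.sum_add_distrib,
    Finset.smul_sum, pd_const_mul]

theorem laplacian_normSqPoly_mul (p : Poly) : laplacian (normSqPoly * p) =
    6 * p + 4 * ∑ i, X i * pderiv i p + normSqPoly * laplacian p := by
  simp only [laplacian_apply, Fin.sum_univ_three, pderiv_mul, map_add, pderiv_normSqPoly]
  simp only [← map_ofNat (C : ℂ →+* Poly), pderiv_C, pderiv_X_self]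
  simp only [map_ofNat]
  ring

theorem laplacian_normSqPoly_smul {j : ℕ} {P : EndPoly m} (hP : IsHomogeneous j P) :
    entrywise laplacian (normSqPoly • P) =
      (6 + 4 * j : ℂ) • P + normSqPoly • entrywise laplacian P := by
  refine ext_entry fun φ => ?_
  rw [entry_entrywise, entry_smul, laplacian_normSqPoly_mul, (hP φ).sum_X_mul_pderiv]
  simp only [map_add, map_smul, entry_smul, entry_entrywise, smul_eq_C_mul, map_mul, map_natCast,
    map_ofNat, nsmul_eq_mul]
  ring

/-- Used with `T = Q₁Q_j`, `Q = Q_{j+1}`, `S = |x|²Q_{j-1}`, `a = a_{j+1}`, `b = a_j`, `d =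
a_{j+2}`. The multiples of `S` cancel, and the multiple of `Q` is the recursion for `a`. -/
theorem smul_recursion_identity {M : Type*} [AddCommGroup M] [Module ℂ M] {a b c d j : ℂ}
    (hj : 2 * j + 3 ≠ 0) (hj' : 2 * j + 1 ≠ 0) {Q S T : M} (hT : T = Q + (b / (2 * j + 1)) • S)
    (hd : d = a * (2 * (j + 1) - 1) / (2 * (j + 1) + 1) + c) :
    a • T + c • Q - (a / (2 * (j + 1) + 1)) • ((2 : ℂ) • T + b • S) = d • Q := by
  subst hT hd
  have hj3 : 2 * (j + 1) + 1 ≠ 0 := by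
    convert hj using 1
    ring
  match_scalars
  · field_simp
    ring
  · field_simp
    ring

/-- The two claims need each other: `ΔQ_{j+2}` involves `D Q_{j+1}`, and `D Q_{j+2}` uses the
harmonicity of `Q_{j+1}`. -/
theorem harmonicQ_spec (j : ℕ) : IsHarmonic j (harmonicQ m j) ∧
    Dtau m (harmonicQ m j) = coeffA m j • harmonicQ m (j - 1) := by
  induction j using Nat.twoStepInduction with
  | zero =>
    have h1 : ∀ i, pd i (1 : EndPoly m) = 0 := fun i => by
      have : (1 : EndPoly m) = 1 ⊗ₜ[ℂ] 1 := rfl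
      rw [this, pd, entrywise_tmul]
      simp
    refine ⟨isHarmonic_iff.2 ⟨isHomogeneous_one, ?_⟩, ?_⟩
    · rw [harmonicQ, entrywise_laplacian]
      simp [h1]
    · rw [harmonicQ, coeffA_zero, zero_smul, Dtau_apply]
      simp [h1]
  | one =>
    have h1 : ∀ i, pd i (1 : EndPoly m) = 0 := fun i => by
      have : (1 : EndPoly m) = 1 ⊗ₜ[ℂ] 1 := rfl
      rw [this, pd, entrywise_tmul]
      simp
    have hD : Dtau m (1 : EndPoly m) = 0 := by simp [Dtau_apply, h1]
    have hL : entrywise laplacian (1 : EndPoly m) = 0 := by simp [entrywise_laplacian, h1]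
    refine ⟨isHarmonic_iff.2 ⟨?_, ?_⟩, ?_⟩
    · simpa [harmonicQ] using (isHomogeneous_one (m := m)).Q1_mul
    · have := laplacian_Q1_mul (1 : EndPoly m)
      rw [hD, hL, mul_one] at this
      simpa [harmonicQ] using this
    · have := Dtau_Q1_mul (isInvariant_one (m := m))
      rw [hD, mul_one, mul_zero, zero_add] at this
      simp only [mul_one, sum_gen_sq] at this
      change Dtau m (Q1 m) = coeffA m 1 • 1
      rw [this, coeffA]
      norm_num
  | more j h0 h1 =>
    obtain ⟨hH0, hD0⟩ := h0
    obtain ⟨hH1, hD1⟩ := h1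
    have hj1 : (2 * (j : ℂ) + 1) ≠ 0 := by exact_mod_cast (by omega : 2 * j + 1 ≠ 0)
    have hj3 : (2 * (j : ℂ) + 3) ≠ 0 := by exact_mod_cast (by omega : 2 * j + 3 ≠ 0)
    have hR := harmonicQ_succ (m := m) (j + 1)
    rw [Nat.add_sub_cancel] at hR hD1
    rw [Nat.cast_add, Nat.cast_one] at hR
    refine ⟨isHarmonic_iff.2 ⟨?_, ?_⟩, ?_⟩
    · rw [hR]
      exact (isHarmonic_iff.1 hH1).1.Q1_mul.sub ((isHarmonic_iff.1 hH0).1.normSqPoly_smul.smul _)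
    · rw [hR, map_sub, map_smul, laplacian_Q1_mul,
        laplacian_normSqPoly_smul (isHarmonic_iff.1 hH0).1, hH1.laplacian_eq_zero, hH0.laplacian_eq_zero, hD1, mul_zero, smul_zero, add_zero, add_zero,
        smul_smul, smul_smul, ← sub_smul]
      -- The denominator in the recursion is dictated here: `Δ(|x|²Q_j) = 2(2j+3)Q_j` must cancel
      -- `Δ(Q₁Q_{j+1}) = 2a_{j+1}Q_j`.
      have : 2 * coeffA m (j + 1) - coeffA m (j + 1) / (2 * (j + 1) + 1) * (6 + 4 * j) = 0 := by
        have hj3' : 2 * ((j : ℂ) + 1) + 1 ≠ 0 := by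
          convert hj3 using 1
          ring
        field_simp
        ring
      rw [this, zero_smul]
    · rw [hR, map_sub, map_smul, Dtau_Q1_mul (isInvariant_harmonicQ _),
        hH1.sum_gen_mul_mul_gen (isInvariant_harmonicQ _), hD1, Dtau_normSqPoly_smul, hD0,
        mul_smul_comm, smul_comm normSqPoly (coeffA m j)]
      refine smul_recursion_identity hj3 hj1 (Q1_mul_harmonicQ j) ?_
      rw [coeffA_succ (j + 1)]
      push_cast
      rfl

end EndPoly

/-! ### Equivariance of `Q₁` under `SO(3)` -/

theorem subst_vectorField_subst {A B B' : Matrix (Fin 3) (Fin 3) ℝ} (h : B' * B = 1) (p : Poly) :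
    subst B (vectorField A (subst B' p)) = vectorField (B' * A * B) p := by
  have hX : ∀ i, subst B (∑ j : Fin 3, C (A i j : ℂ) * X j) =
      ∑ j : Fin 3, C ((A * B) i j : ℂ) * X j := by
    intro i
    simp only [subst, map_sum, map_mul, aeval_X, algHom_C, algebraMap_eq, Matrix.mul_apply,
      Complex.ofReal_sum, Complex.ofReal_mul, Finset.mul_sum, Finset.sum_mul]
    rw [Finset.sum_comm]
    simp only [mul_assoc]
  have hp : ∀ q : Poly, subst B (subst B' q) = q := fun q => by
    rw [subst_subst, h, subst_one]
  have hC : ∀ a : ℂ, subst B (C a) = C a := fun a => by simp [subst]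
  have hD : ∀ i, subst B (pderiv i (subst B' p)) = ∑ l, C (B' l i : ℂ) * pderiv l p := fun i => by
    rw [pderiv_subst, map_sum]
    exact Finset.sum_congr rfl fun l _ => by rw [map_mul, hC, hp]
  have hM : ∀ l j : Fin 3, (C ((B' * A * B) l j : ℂ) : Poly) =
      ∑ i, C (B' l i : ℂ) * C ((A * B) i j : ℂ) := fun l j => by
    rw [Matrix.mul_assoc, Matrix.mul_apply, Complex.ofReal_sum, map_sum]
    exact Finset.sum_congr rfl fun i _ => by rw [Complex.ofReal_mul, map_mul]
  rw [vectorField_apply, vectorField_apply, map_neg]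
  refine congrArg Neg.neg ((map_sum (subst B) _ _).trans ?_)
  have hT : ∀ i, subst B ((∑ j : Fin 3, C (A i j : ℂ) * X j) * pderiv i (subst B' p)) =
      ∑ l : Fin 3, ∑ j : Fin 3, C (B' l i : ℂ) * C ((A * B) i j : ℂ) * X j * pderiv l p := by
    intro i
    rw [map_mul, hX, hD, Finset.mul_sum]
    refine Finset.sum_congr rfl fun l _ => ?_
    rw [Finset.sum_mul]
    exact Finset.sum_congr rfl fun j _ => by ring
  rw [Finset.sum_congr rfl fun i _ => hT i, Finset.sum_comm]
  refine Finset.sum_congr rfl fun l _ => ?_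
  rw [Finset.sum_comm, Finset.sum_mul]
  refine Finset.sum_congr rfl fun j _ => ?_
  rw [hM, Finset.sum_mul, Finset.sum_mul]

theorem SO3.transpose_eq_adjugate (k : SO3) :
    (k : Matrix (Fin 3) (Fin 3) ℝ).transpose = (k : Matrix (Fin 3) (Fin 3) ℝ).adjugate := by
  have h1 := SO3.mul_transpose k
  have h2 : (k : Matrix (Fin 3) (Fin 3) ℝ).det = 1 :=
    (Matrix.mem_specialOrthogonalGroup_iff.1 k.2).2
  have h3 := Matrix.mul_adjugate (k : Matrix (Fin 3) (Fin 3) ℝ)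
  rw [h2, one_smul] at h3
  exact left_inv_eq_right_inv (mul_eq_one_comm.1 h1) h3

/-- Rotations preserve the cross product. In coordinates, the entries on the left are 2×2 minors of
`k`, and these are entries of `k` because its transpose is its adjugate. -/
theorem SO3.conj_basisMatrix (k : SO3) (l : Fin 3) :
    (k : Matrix (Fin 3) (Fin 3) ℝ) * basisMatrix l * (k : Matrix (Fin 3) (Fin 3) ℝ).transpose =
      ∑ i : Fin 3, (k : Matrix (Fin 3) (Fin 3) ℝ) i l • basisMatrix i := by
  have h := SO3.transpose_eq_adjugate k
  rw [Matrix.adjugate_fin_three] at h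
  have e : ∀ i j, (k : Matrix (Fin 3) (Fin 3) ℝ) j i = _ := fun i j => congrFun (congrFun h i) j
  have e00 := e 0 0
  have e01 := e 0 1
  have e02 := e 0 2
  have e10 := e 1 0
  have e11 := e 1 1
  have e12 := e 1 2
  have e20 := e 2 0
  have e21 := e 2 1
  have e22 := e 2 2
  simp at e00 e01 e02 e10 e11 e12 e20 e21 e22
  ext a b
  fin_cases l <;> fin_cases a <;> fin_cases b <;>
    simp [Matrix.mul_apply, Fin.sum_univ_three, basisMatrix] <;> linarith

variable {m : ℕ}

theorem tau_mul_dtau_mul_tau_inv (k : SO3) (l : Fin 3) :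
    tau m k * dtau m (basisY l) * tau m k⁻¹ =
      ∑ i : Fin 3, ((k : Matrix (Fin 3) (Fin 3) ℝ) i l : ℂ) • dtau m (basisY i) := by
  refine LinearMap.ext fun p => Subtype.ext ?_
  have h1 : subst ((k⁻¹ : SO3) : Matrix (Fin 3) (Fin 3) ℝ) (vectorField (basisMatrix l)
      (subst (((k⁻¹)⁻¹ : SO3) : Matrix (Fin 3) (Fin 3) ℝ) (p : Poly))) =
      vectorField (∑ i : Fin 3, (k : Matrix (Fin 3) (Fin 3) ℝ) i l • basisMatrix i) p := by
    rw [inv_inv, ← SO3.conj_basisMatrix]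
    exact subst_vectorField_subst (SO3.mul_transpose k) _
  rw [LinearMap.sum_apply, AddSubmonoidClass.coe_finsetSum]
  refine h1.trans ?_
  simp only [Fin.sum_univ_three, vectorField_add, vectorField_smul]
  rfl

/-! ### Equivariance of `Q₁`, its powers and the `Q_j`. -/

namespace EndPoly

theorem tau_inv_mul_tau (k : SO3) : tau m k⁻¹ * tau m k = 1 := by
  rw [← map_mul, inv_mul_cancel, map_one]

theorem tau_mul_tau_inv (k : SO3) : tau m k * tau m k⁻¹ = 1 := by
  rw [← map_mul, mul_inv_cancel, map_one]

theorem mul_mem_equivariantPoly {P Q : EndPoly m} (hP : P ∈ equivariantPoly m)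
    (hQ : Q ∈ equivariantPoly m) : P * Q ∈ equivariantPoly m := fun k x => by
  rw [map_mul, hP k x, hQ k x, map_mul]
  simp only [mul_assoc]
  rw [← mul_assoc (tau m k⁻¹) (tau m k), tau_inv_mul_tau, one_mul]

theorem one_mem_equivariantPoly : (1 : EndPoly m) ∈ equivariantPoly m := fun k x => by
  rw [map_one, map_one, mul_one, tau_mul_tau_inv]

theorem evalAt_Q1 (x : Fin 3 → ℝ) :
    EndPoly.evalAt x (Q1 m) = ∑ i : Fin 3, (x i : ℂ) • dtau m (basisY i) := by
  rw [Q1, map_sum]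
  simp only [evalAt_tmul]
  simp [EuclideanMotion.evalAt]

theorem Q1_mem_equivariantPoly : Q1 m ∈ equivariantPoly m := fun k x => by
  rw [evalAt_Q1, evalAt_Q1, Finset.mul_sum, Finset.sum_mul]
  simp only [mul_smul_comm, smul_mul_assoc, tau_mul_dtau_mul_tau_inv, Matrix.mulVec, dotProduct,
    Complex.ofReal_sum, Complex.ofReal_mul, Finset.sum_smul, Finset.smul_sum, smul_smul]
  rw [Finset.sum_comm]
  simp only [mul_comm]

theorem Q1_pow_mem_equivariantPoly (j : ℕ) : Q1 m ^ j ∈ equivariantPoly m := by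
  induction j with
  | zero => exact pow_zero (Q1 m) ▸ one_mem_equivariantPoly
  | succ j hj => exact pow_succ (Q1 m) j ▸ mul_mem_equivariantPoly hj Q1_mem_equivariantPoly

theorem smul_mem_radial {N : Submodule radialPoly (EndPoly m)} (c : ℂ) {P : EndPoly m}
    (hP : P ∈ N) : c • P ∈ N := by
  have := N.smul_mem (algebraMap ℂ radialPoly c) hP
  rwa [algebraMap_smul] at this

theorem normSqPoly_mem : normSqPoly ∈ radialPoly := Algebra.subset_adjoin rfl

theorem normSqPoly_smul_mem {N : Submodule radialPoly (EndPoly m)} {P : EndPoly m}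
    (hP : P ∈ N) : normSqPoly • P ∈ N :=
  N.smul_mem (⟨normSqPoly, normSqPoly_mem⟩ : radialPoly) hP

theorem harmonicQ_mem_equivariantPoly (j : ℕ) : harmonicQ m j ∈ equivariantPoly m := by
  induction j using Nat.twoStepInduction with
  | zero => exact one_mem_equivariantPoly
  | one => exact Q1_mem_equivariantPoly
  | more j h0 h1 =>
    exact Submodule.sub_mem _ (mul_mem_equivariantPoly Q1_mem_equivariantPoly h1)
      (smul_mem_radial _ (normSqPoly_smul_mem h0))

theorem harmonicEquivariant_iff {j : ℕ} {P : EndPoly m} :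
    P ∈ harmonicEquivariant m j ↔ P ∈ equivariantPoly m ∧ IsHarmonic j P := by
  simp [harmonicEquivariant, IsHarmonic]

end EndPoly

/-! ### Rotations -/

/-- The rotation by the angle `θ` about the third axis, the exponential of `θ Y₃`. -/
def rotZ (θ : ℝ) : SO3 :=
  ⟨!![Real.cos θ, Real.sin θ, 0; -Real.sin θ, Real.cos θ, 0; 0, 0, 1], by
    have h := Real.cos_sq_add_sin_sq θ
    rw [Matrix.mem_specialOrthogonalGroup_iff, Matrix.mem_orthogonalGroup_iff]
    refine ⟨?_, ?_⟩
    · ext i j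
      fin_cases i <;> fin_cases j <;> simp [Matrix.mul_apply, Fin.sum_univ_three] <;> linarith
    · simp [Matrix.det_fin_three]
      linarith⟩

/-- The rotation by the angle `θ` about the second axis. -/
def rotY (θ : ℝ) : SO3 :=
  ⟨!![Real.cos θ, 0, Real.sin θ; 0, 1, 0; -Real.sin θ, 0, Real.cos θ], by
    have h := Real.cos_sq_add_sin_sq θ
    rw [Matrix.mem_specialOrthogonalGroup_iff, Matrix.mem_orthogonalGroup_iff]
    refine ⟨?_, ?_⟩
    · ext i j
      fin_cases i <;> fin_cases j <;> simp [Matrix.mul_apply, Fin.sum_univ_three] <;> linarith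
    · simp [Matrix.det_fin_three]
      linarith⟩

theorem rotZ_mulVec (θ r : ℝ) :
    (rotZ θ : Matrix (Fin 3) (Fin 3) ℝ).mulVec ![0, 0, r] = ![0, 0, r] := by
  ext i
  fin_cases i <;> simp [rotZ]

theorem rotY_pi_mulVec (r : ℝ) :
    (rotY Real.pi : Matrix (Fin 3) (Fin 3) ℝ).mulVec ![0, 0, r] = ![0, 0, -r] := by
  ext i
  fin_cases i <;> simp [rotY]

theorem SO3.exists_mulVec_eq (x : Fin 3 → ℝ) :
    ∃ (k : SO3) (r : ℝ), (k : Matrix (Fin 3) (Fin 3) ℝ).mulVec ![0, 0, r] = x := by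
  let z : ℂ := ⟨x 0, x 1⟩
  let w : ℂ := ⟨x 2, ‖z‖⟩
  have h1 : ‖z‖ * Real.cos z.arg = x 0 := Complex.norm_mul_cos_arg z
  have h2 : ‖z‖ * Real.sin z.arg = x 1 := Complex.norm_mul_sin_arg z
  have h3 : ‖w‖ * Real.cos w.arg = x 2 := Complex.norm_mul_cos_arg w
  have h4 : ‖w‖ * Real.sin w.arg = ‖z‖ := Complex.norm_mul_sin_arg w
  -- Spherical coordinates: `w.arg` is the colatitude and `z.arg` the longitude. The sign appears
  -- because `rotZ θ` turns the first two axes clockwise.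
  refine ⟨rotZ (-z.arg) * rotY w.arg, ‖w‖, ?_⟩
  change ((rotZ (-z.arg) : Matrix (Fin 3) (Fin 3) ℝ) * (rotY w.arg :
    Matrix (Fin 3) (Fin 3) ℝ)).mulVec _ = x
  ext i
  fin_cases i <;> simp [rotZ, rotY, Matrix.mul_apply, Matrix.mulVec, dotProduct,
    Fin.sum_univ_three]
  · rw [← h1, ← h4]; ring
  · rw [← h2, ← h4]; ring
  · rw [← h3]; ring

/-! ### The dimension of the space of harmonic polynomials -/

theorem coeff_pderiv_pderiv (i : Fin 3) (p : Poly) (d : Fin 3 →₀ ℕ) :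
    coeff d (pderiv i (pderiv i p)) =
      coeff (d + Finsupp.single i 2) p * ((d i + 2) * (d i + 1)) := by
  rw [coeff_pderiv, coeff_pderiv, add_assoc, ← Finsupp.single_add]
  simp
  ring

/-- The equation `Δp = 0` expresses each coefficient with exponent `n + 2` of `x₃` through
coefficients with exponent `n`. -/
theorem eq_zero_of_coeff_eq_zero {p : Poly} (hp : laplacian p = 0)
    (h : ∀ d : Fin 3 →₀ ℕ, d 2 ≤ 1 → coeff d p = 0) : p = 0 := by
  have key : ∀ n (d : Fin 3 →₀ ℕ), d 2 = n → coeff d p = 0 := by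
    intro n
    induction n using Nat.strong_induction_on with
    | _ n ih =>
      intro d hd
      by_cases hn : n ≤ 1
      · exact h d (hd.le.trans hn)
      · let d' : Fin 3 →₀ ℕ := d - Finsupp.single 2 2
        have hd' : d' + Finsupp.single 2 2 = d := by
          refine tsub_add_cancel_of_le ?_
          rw [Finsupp.single_le_iff]
          omega
        have hd2 : d' 2 + 2 = n := by
          rw [← hd, ← hd']
          simp
        have hc := congrArg (coeff d') hp
        rw [laplacian_apply, Fin.sum_univ_three, coeff_add, coeff_add, coeff_pderiv_pderiv,
          coeff_pderiv_pderiv, coeff_pderiv_pderiv, hd', coeff_zero,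
          ih (d' 2) (by omega) (d' + Finsupp.single 0 2) (by simp),
          ih (d' 2) (by omega) (d' + Finsupp.single 1 2) (by simp), zero_mul, zero_mul, zero_add,
          zero_add] at hc
        refine (mul_eq_zero.1 hc).resolve_right ?_
        exact_mod_cast (by positivity : (d' 2 + 2) * (d' 2 + 1) ≠ 0)
  ext d
  rw [key _ d rfl, coeff_zero]

/-- The coefficients of the monomials of degree at most one in the third variable. -/
def coeffMap (m : ℕ) : harmonic m →ₗ[ℂ] (Fin (m + 1) → ℂ) × (Fin m → ℂ) :=
  ((LinearMap.pi fun a : Fin (m + 1) =>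
      lcoeff ℂ (Finsupp.equivFunOnFinite.symm ![(a : ℕ), m - a, 0])).prod
    (LinearMap.pi fun a : Fin m =>
      lcoeff ℂ (Finsupp.equivFunOnFinite.symm ![(a : ℕ), m - 1 - a, 1]))) ∘ₗ (harmonic m).subtype

theorem coeffMap_injective : Function.Injective (coeffMap m) := by
  rw [injective_iff_map_eq_zero]
  intro p hp
  refine Subtype.ext (eq_zero_of_coeff_eq_zero p.2.2 fun d hd => ?_)
  by_contra hc
  have hdeg : d 0 + d 1 + d 2 = m := by
    have h1 : (p : Poly).IsHomogeneous m := p.2.1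
    have := h1 hc
    simpa [Finsupp.weight_apply, Finsupp.sum_fintype, Fin.sum_univ_three] using this
  rw [Prod.ext_iff] at hp
  refine hc ?_
  rcases Nat.le_one_iff_eq_zero_or_eq_one.1 hd with h0 | h1
  · have := congrFun hp.1 ⟨d 0, by omega⟩
    have e : Finsupp.equivFunOnFinite.symm ![d 0, m - d 0, 0] = d := by
      ext i
      fin_cases i <;> simp <;> omega
    simpa [coeffMap, e] using this
  · have := congrFun hp.2 ⟨d 0, by omega⟩
    have e : Finsupp.equivFunOnFinite.symm ![d 0, m - 1 - d 0, 1] = d := by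
      ext i
      fin_cases i <;> simp <;> omega
    simpa [coeffMap, e] using this

instance : Module.Finite ℂ (harmonic m) := Module.Finite.of_injective _ coeffMap_injective

theorem finrank_harmonic_le : Module.finrank ℂ (harmonic m) ≤ 2 * m + 1 := by
  have := LinearMap.finrank_le_finrank_of_injective (coeffMap_injective (m := m))
  simp at this
  omega

/-! ### The weight basis -/

/-- The usual `sl₂` string: `f` lowers the weight by one, and commuting `e` past the powers of `f`
accumulates the factor `(n+1)(2μ-n)`. For `μ = m` it is nonzero as long as `n < 2m`. -/
theorem weight_string {V : Type*} [AddCommGroup V] [Module ℂ V] {e f t : Module.End ℂ V}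
    (hef : e * f = f * e + (2 : ℂ) • t) (htf : t * f = f * t + (-Complex.I) • f)
    {v : V} {μ : ℂ} (hv : t v = (Complex.I * μ) • v) (hev : e v = 0) (n : ℕ) :
    t ((f ^ n) v) = (Complex.I * (μ - n)) • (f ^ n) v ∧
      e ((f ^ (n + 1)) v) = (Complex.I * ((n + 1) * (2 * μ - n))) • (f ^ n) v := by
  have hs : ∀ k, (f ^ (k + 1)) v = f ((f ^ k) v) := fun k => by
    rw [pow_succ', Module.End.mul_apply]
  have hef' : ∀ w, e (f w) = f (e w) + (2 : ℂ) • t w := fun w => DFunLike.congr_fun hef w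
  have htf' : ∀ w, t (f w) = f (t w) + (-Complex.I) • f w := fun w => DFunLike.congr_fun htf w
  induction n with
  | zero =>
    refine ⟨by simp [hv], ?_⟩
    rw [hs, hef', pow_zero, Module.End.one_apply, hv, hev, map_zero, zero_add, smul_smul]
    congr 1
    push_cast
    ring
  | succ n ih =>
    have h1 : t ((f ^ (n + 1)) v) = (Complex.I * (μ - (n + 1 : ℕ))) • (f ^ (n + 1)) v := by
      rw [hs, htf', ih.1, map_smul, ← add_smul]
      congr 1
      push_cast
      ring
    refine ⟨h1, ?_⟩
    rw [hs (n + 1), hef', h1, ih.2, map_smul, ← hs, smul_smul, ← add_smul]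
    congr 1
    push_cast
    ring

/-- The polynomial `(x₁ + i x₂)^m`. -/
def highestPoly (m : ℕ) : Poly := (X 0 + C Complex.I * X 1) ^ m

theorem C_I_sq : (C Complex.I : Poly) ^ 2 = -1 := by
  rw [← map_pow, Complex.I_sq, map_neg, map_one]

theorem highestPoly_mem : highestPoly m ∈ harmonic m := by
  refine ⟨?_, ?_⟩
  · have h1 : (X 0 + C Complex.I * X 1 : Poly).IsHomogeneous 1 :=
      (isHomogeneous_X _ _).add (isHomogeneous_C_mul_X _ _)
    simpa [highestPoly] using h1.pow m
  · change laplacian (highestPoly m) = 0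
    rw [laplacian_apply, highestPoly, Fin.sum_univ_three]
    simp only [pderiv_pow, pderiv_mul, map_add, pderiv_X, pderiv_C]
    simp only [← map_natCast (C : ℂ →+* Poly), pderiv_C]
    simp
    have := C_I_sq
    linear_combination
      ((m : Poly) * ((m - 1 : ℕ) : Poly) * (X 0 + C Complex.I * X 1) ^ (m - 1 - 1)) * this

/-- A highest weight vector of `H_m`. -/
def highestVector (m : ℕ) : harmonic m := ⟨highestPoly m, highestPoly_mem⟩

theorem highestVector_ne_zero : highestVector m ≠ 0 := by
  intro h
  have h1 : highestPoly m = 0 := congrArg Subtype.val h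
  have h2 := congrArg (evalAt ![1, 0, 0]) h1
  simp [highestPoly, evalAt] at h2

theorem dtau_two_highestVector :
    dtau m (basisY 2) (highestVector m) = (Complex.I * m) • highestVector m := by
  refine Subtype.ext ?_
  change vectorField (basisMatrix 2) (highestPoly m) = (Complex.I * m) • highestPoly m
  rw [vectorField_basisMatrix, highestPoly, smul_eq_C_mul]
  rcases m with _ | m
  · simp
  · simp [pderiv_X]
    have := C_I_sq
    linear_combination (-(m + 1) * (X 0 + C Complex.I * X 1) ^ m * X 1) * this

theorem dtau_raise_highestVector :
    ((-Complex.I) • dtau m (basisY 0) + dtau m (basisY 1)) (highestVector m) = 0 := by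
  refine Subtype.ext ?_
  change (-Complex.I) • vectorField (basisMatrix 0) (highestPoly m) +
    vectorField (basisMatrix 1) (highestPoly m) = 0
  rw [vectorField_basisMatrix, vectorField_basisMatrix, highestPoly, smul_eq_C_mul]
  simp [pderiv_X]
  have := C_I_sq
  linear_combination (m * (X 0 + C Complex.I * X 1) ^ (m - 1) * X 2) * this

/-- The lowering operator `dτ(Y₁) - i dτ(Y₂)`. -/
def lowering (m : ℕ) : Module.End ℂ (harmonic m) :=
  dtau m (basisY 0) + (-Complex.I) • dtau m (basisY 1)

theorem lowering_identities {R : Type*} [Ring R] [Algebra ℂ R] {a b c : R}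
    (h₀ : b * a = a * b + c) (h₁ : c * b = b * c + a) (h₂ : a * c = c * a + b) :
    ((-Complex.I) • a + b) * (a + (-Complex.I) • b) =
      (a + (-Complex.I) • b) * ((-Complex.I) • a + b) + (2 : ℂ) • c ∧
    c * (a + (-Complex.I) • b) =
      (a + (-Complex.I) • b) * c + (-Complex.I) • (a + (-Complex.I) • b) := by
  have hI := Complex.I_sq
  have h₂' : c * a = a * c - b := by rw [h₂]; abel
  constructor
  · simp only [mul_add, add_mul, smul_mul_assoc, mul_smul_comm, h₀, smul_add]
    match_scalars <;> first | ring1 | linear_combination hI | linear_combination (-1) * hI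
  · simp only [mul_add, add_mul, smul_mul_assoc, mul_smul_comm, h₁, h₂', smul_add]
    match_scalars <;> first | ring1 | linear_combination hI | linear_combination (-1) * hI

/-- The weight vectors `Fⁿ (x₁ + i x₂)^m`. -/
def weightVector (m n : ℕ) : harmonic m := (lowering m ^ n) (highestVector m)

theorem weightVector_string (n : ℕ) :
    dtau m (basisY 2) (weightVector m n) = (Complex.I * (m - n)) • weightVector m n ∧
      ((-Complex.I) • dtau m (basisY 0) + dtau m (basisY 1)) (weightVector m (n + 1)) =
        (Complex.I * ((n + 1) * (2 * m - n))) • weightVector m n := by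
  have h := lowering_identities (R := Module.End ℂ (harmonic m)) (a := dtau m (basisY 0))
    (b := dtau m (basisY 1)) (c := dtau m (basisY 2)) (EndPoly.dtau_mul 0) (EndPoly.dtau_mul 1)
    (EndPoly.dtau_mul 2)
  exact weight_string h.1 h.2 dtau_two_highestVector dtau_raise_highestVector n

theorem weightVector_ne_zero {n : ℕ} (hn : n ≤ 2 * m) : weightVector m n ≠ 0 := by
  induction n with
  | zero => exact highestVector_ne_zero
  | succ n ih =>
    intro h0
    have h := (weightVector_string (m := m) n).2
    rw [h0, map_zero] at h
    refine smul_ne_zero (mul_ne_zero Complex.I_ne_zero (mul_ne_zero ?_ ?_)) (ih (by omega)) h.symm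
    · exact Nat.cast_add_one_ne_zero n
    · rw [sub_ne_zero]
      exact_mod_cast (by omega : 2 * m ≠ n)

theorem weightVector_linearIndependent :
    LinearIndependent ℂ fun n : Fin (2 * m + 1) => weightVector m n := by
  refine Module.End.eigenvectors_linearIndependent' (dtau m (basisY 2))
    (fun n : Fin (2 * m + 1) => Complex.I * ((m : ℂ) - (n : ℕ))) ?_ _ fun n =>
      ⟨Module.End.mem_eigenspace_iff.2 (weightVector_string n).1,
        weightVector_ne_zero (by omega)⟩
  intro a b hab
  have := sub_right_injective (mul_left_cancel₀ Complex.I_ne_zero hab)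
  exact Fin.ext (by exact_mod_cast this)

/-- The basis of weight vectors. -/
def weightBasis (m : ℕ) : Module.Basis (Fin (2 * m + 1)) ℂ (harmonic m) :=
  basisOfLinearIndependentOfCardEqFinrank weightVector_linearIndependent
    (le_antisymm weightVector_linearIndependent.fintype_card_le_finrank
      (by simpa using finrank_harmonic_le))

theorem weightBasis_apply (n : Fin (2 * m + 1)) :
    weightBasis m n = weightVector m n := by
  rw [weightBasis, coe_basisOfLinearIndependentOfCardEqFinrank]

/-- Applied to the highest weight vector, the powers give the independent weight vectors. This
independence is what allows cancelling `|x|²`. -/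
theorem lowering_pow_linearIndependent {c : Fin (2 * m + 1) → ℂ}
    (h : ∑ j, c j • lowering m ^ (j : ℕ) = 0) : c = 0 := by
  have h1 := DFunLike.congr_fun h (highestVector m)
  rw [LinearMap.sum_apply] at h1
  exact funext (Fintype.linearIndependent_iff.1 weightVector_linearIndependent c h1)

/-! ### The centralizer of a rotation about the third axis -/

theorem tau_rotZ_lowering (θ : ℝ) : tau m (rotZ θ) * lowering m =
    Complex.exp (-θ * Complex.I) • (lowering m * tau m (rotZ θ)) := by
  have h : tau m (rotZ θ) * lowering m * tau m (rotZ θ)⁻¹ =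
      Complex.exp (-θ * Complex.I) • lowering m := by
    rw [lowering, mul_add, add_mul, mul_smul_comm, smul_mul_assoc, tau_mul_dtau_mul_tau_inv,
      tau_mul_dtau_mul_tau_inv, Complex.exp_mul_I]
    simp only [Fin.sum_univ_three, rotZ]
    simp only [Matrix.of_apply, Matrix.cons_val_zero, Matrix.cons_val_one, Matrix.cons_val,
      Complex.cos_neg, Complex.sin_neg, Complex.ofReal_cos, Complex.ofReal_sin, Complex.ofReal_neg,
      Complex.ofReal_zero, zero_smul, add_zero]
    have hI := Complex.I_sq
    match_scalars
    · ring
    · linear_combination (- Complex.sin θ) * hI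
  have h2 := congrArg (· * tau m (rotZ θ)) h
  simp only [mul_assoc, EndPoly.tau_inv_mul_tau, mul_one, smul_mul_assoc] at h2
  exact h2

theorem tau_rotZ_highestVector (θ : ℝ) : tau m (rotZ θ) (highestVector m) =
    Complex.exp (m * (θ * Complex.I)) • highestVector m := by
  refine Subtype.ext ?_
  change subst ((rotZ θ)⁻¹ : SO3) (highestPoly m) = _ • highestPoly m
  have h : subst ((rotZ θ)⁻¹ : SO3) (X 0 + C Complex.I * X 1) =
      C (Complex.exp (θ * Complex.I)) * (X 0 + C Complex.I * X 1) := by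
    have hC : ∀ a : ℂ, subst ((rotZ θ)⁻¹ : SO3) (C a) = C a := fun a => by simp [subst]
    rw [map_add, map_mul, hC]
    simp only [subst, aeval_X, SO3.inv_apply, Fin.sum_univ_three, rotZ]
    rw [Complex.exp_mul_I]
    simp
    have := C_I_sq
    linear_combination (-C (Complex.sin θ) * X 1) * this
  rw [highestPoly, map_pow, h, mul_pow, ← map_pow, ← Complex.exp_nat_mul, smul_eq_C_mul]

theorem tau_rotZ_weightVector (θ : ℝ) (n : ℕ) : tau m (rotZ θ) (weightVector m n) =
    Complex.exp (((m : ℂ) - n) * (θ * Complex.I)) • weightVector m n := by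
  induction n with
  | zero =>
    rw [Nat.cast_zero, sub_zero]
    exact tau_rotZ_highestVector θ
  | succ n ih =>
    have hs : weightVector m (n + 1) = lowering m (weightVector m n) := by
      rw [weightVector, pow_succ', Module.End.mul_apply]
      rfl
    have h := DFunLike.congr_fun (tau_rotZ_lowering (m := m) θ) (weightVector m n)
    rw [hs]
    refine h.trans ?_
    rw [LinearMap.smul_apply, Module.End.mul_apply, ih, map_smul, smul_smul, ← Complex.exp_add]
    congr 2
    push_cast
    ring

/-- The angle `1/(m+1)` puts all phases `(m-n)/(m+1)` inside `(-1,1)`, where `θ ↦ exp(iθ)` is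
injective, so a single rotation separates the weights. -/
theorem exp_weight_injective :
    Function.Injective fun n : Fin (2 * m + 1) =>
      Complex.exp (((m : ℂ) - (n : ℕ)) * (((1 / (m + 1) : ℝ) : ℂ) * Complex.I)) := by
  have hm : (0 : ℝ) < m + 1 := by positivity
  have him : ∀ n : Fin (2 * m + 1), ((m : ℂ) - (n : ℕ)) * (((1 / (m + 1) : ℝ) : ℂ) * Complex.I) =
      (((m - (n : ℕ) : ℝ) / (m + 1) : ℝ) : ℂ) * Complex.I := fun n => by
    push_cast
    ring
  have hb : ∀ n : Fin (2 * m + 1), -Real.pi < ((m - (n : ℕ) : ℝ) / (m + 1)) ∧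
      ((m - (n : ℕ) : ℝ) / (m + 1)) ≤ Real.pi := fun n => by
    have hpi := Real.pi_gt_three
    have hn : ((n : ℕ) : ℝ) ≤ 2 * m := by exact_mod_cast Nat.lt_succ_iff.1 n.2
    have hn0 : (0 : ℝ) ≤ ((n : ℕ) : ℝ) := Nat.cast_nonneg _
    constructor
    · rw [lt_div_iff₀ hm]
      nlinarith
    · rw [div_le_iff₀ hm]
      nlinarith
  intro a b hab
  simp only [him] at hab
  have hi : ∀ x : ℝ, ((x : ℂ) * Complex.I).im = x := fun x => by simp
  have := Complex.exp_inj_of_neg_pi_lt_of_le_pi (by rw [hi]; exact (hb a).1)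
    (by rw [hi]; exact (hb a).2) (by rw [hi]; exact (hb b).1) (by rw [hi]; exact (hb b).2) hab
  have h2 := Complex.ofReal_injective (mul_right_cancel₀ Complex.I_ne_zero this)
  rw [div_left_inj' hm.ne'] at h2
  exact Fin.ext (by exact_mod_cast sub_right_injective h2)

/-- The coefficients of an operator commuting with the rotations about the third axis, as a
polynomial in `dτ(Y₃)`. -/
def axialCoeff (m : ℕ) (j : ℕ) : Module.Dual ℂ (Module.End ℂ (harmonic m)) :=
  Polynomial.lcoeff ℂ j ∘ₗ Lagrange.interpolate Finset.univ
    (fun n : Fin (2 * m + 1) => Complex.I * ((m : ℂ) - (n : ℕ))) ∘ₗ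
      LinearMap.pi fun n => (weightBasis m).coord n ∘ₗ LinearMap.applyₗ (weightBasis m n)

/-- An operator commuting with one of simple spectrum is diagonal in its eigenbasis. Interpolating
the diagonal entries at the `2m+1` distinct eigenvalues of `dτ(Y₃)` writes it as a polynomial in
`dτ(Y₃)`. The coefficients depend linearly on `B`, hence polynomially on `x` when `B = P(x)`. -/
theorem eq_sum_axialCoeff_smul {B : Module.End ℂ (harmonic m)}
    (hB : Commute B (tau m (rotZ (1 / (m + 1))))) :
    B = ∑ j ∈ Finset.range (2 * m + 1), axialCoeff m j B • dtau m (basisY 2) ^ j := by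
  let μ : Fin (2 * m + 1) → ℂ := fun n => Complex.I * ((m : ℂ) - (n : ℕ))
  have hμ : Function.Injective μ := fun a b hab => by
    have := sub_right_injective (mul_left_cancel₀ Complex.I_ne_zero hab)
    exact Fin.ext (by exact_mod_cast this)
  let r : Fin (2 * m + 1) → ℂ := fun n => (weightBasis m).coord n (B (weightBasis m n))
  let p : Polynomial ℂ := Lagrange.interpolate Finset.univ μ r
  have hr : ∀ n, B (weightBasis m n) = r n • weightBasis m n := by
    intro n
    refine (weightBasis m).ext_elem fun k => ?_
    by_cases hk : k = n
    · subst hk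
      simp [r]
    -- Off the diagonal, comparing `k`-th coordinates in the commutation relation gives `(εₙ - εₖ)
    -- Bₖₙ = 0`.
    · let ε : Fin (2 * m + 1) → ℂ := fun n =>
        Complex.exp (((m : ℂ) - (n : ℕ)) * (((1 / (m + 1) : ℝ) : ℂ) * Complex.I))
      have hT : ∀ w k, (weightBasis m).repr (tau m (rotZ (1 / (m + 1))) w) k =
          ε k * (weightBasis m).repr w k := by
        intro w k
        have : (weightBasis m).coord k ∘ₗ tau m (rotZ (1 / (m + 1))) =
            ε k • (weightBasis m).coord k := by
          refine (weightBasis m).ext fun l => ?_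
          simp only [LinearMap.comp_apply, LinearMap.smul_apply]
          rw [weightBasis_apply, tau_rotZ_weightVector, map_smul, ← weightBasis_apply]
          by_cases hl : l = k
          · subst hl
            rfl
          · simp [hl]
        exact DFunLike.congr_fun this w
      have h1 := DFunLike.congr_fun hB.eq (weightBasis m n)
      rw [Module.End.mul_apply, Module.End.mul_apply, weightBasis_apply, tau_rotZ_weightVector,
        map_smul, ← weightBasis_apply] at h1
      have h2 := congrArg (fun w => (weightBasis m).repr w k) h1
      simp only [hT, map_smul, Finsupp.smul_apply, smul_eq_mul] at h2
      have h3 : ε n ≠ ε k := fun h => hk (exp_weight_injective h).symm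
      have h4 : (ε n - ε k) * (weightBasis m).repr (B (weightBasis m n)) k = 0 := by
        rw [sub_mul]
        exact sub_eq_zero.2 h2
      rw [(mul_eq_zero.1 h4).resolve_left (sub_ne_zero.2 h3)]
      simp [Ne.symm hk]
  have hdeg : p.natDegree < 2 * m + 1 := by
    by_cases h0 : p = 0
    · rw [h0]
      simp
    · rw [Polynomial.natDegree_lt_iff_degree_lt h0]
      have := Lagrange.degree_interpolate_lt r (hμ.injOn (s := (Finset.univ :
        Finset (Fin (2 * m + 1)))))
      rwa [Finset.card_univ, Fintype.card_fin] at this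
  have hpow : ∀ (j : ℕ) n, (dtau m (basisY 2) ^ j) (weightBasis m n) =
      μ n ^ j • weightBasis m n := by
    intro j n
    induction j with
    | zero => simp
    | succ j ih =>
      rw [pow_succ', Module.End.mul_apply, ih, map_smul, weightBasis_apply,
        (weightVector_string n).1, smul_smul, pow_succ]
  refine (weightBasis m).ext fun n => ?_
  rw [hr, LinearMap.sum_apply]
  simp only [LinearMap.smul_apply, hpow, smul_smul, ← Finset.sum_smul]
  congr 1
  have h5 : p.eval (μ n) = r n :=
    Lagrange.eval_interpolate_at_node r hμ.injOn (Finset.mem_univ n)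
  rw [← h5, Polynomial.eval_eq_sum_range' hdeg]
  rfl

namespace EndPoly

/-! ### Evaluation at an isotropic point of `ℂ³` -/

/-- Evaluation of scalar polynomials at the isotropic point `(1, -i, 0)`. -/
def isoScalar : Poly →ₐ[ℂ] ℂ := aeval ![1, -Complex.I, 0]

/-- Evaluation of `End(V)`-valued polynomials at the isotropic point `(1, -i, 0)`. -/
def isoEval : EndPoly m →ₐ[ℂ] Module.End ℂ (harmonic m) :=
  Algebra.TensorProduct.lift ((Algebra.ofId ℂ _).comp isoScalar)
    (AlgHom.id ℂ _) fun p A => by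
      rw [AlgHom.comp_apply, Algebra.ofId_apply]
      exact Algebra.commute_algebraMap_left _ _

theorem isoEval_tmul (p : Poly) (A : Module.End ℂ (harmonic m)) :
    isoEval (p ⊗ₜ[ℂ] A) = isoScalar p • A := by
  rw [isoEval, Algebra.TensorProduct.lift_tmul, AlgHom.comp_apply, Algebra.ofId_apply,
    Algebra.smul_def]
  rfl

theorem isoEval_smul (p : Poly) (P : EndPoly m) :
    isoEval (p • P) = isoScalar p • isoEval P := by
  induction P using TensorProduct.induction_on with
  | zero => simp
  | tmul q A => rw [smul_tmul', isoEval_tmul, isoEval_tmul, smul_eq_mul, map_mul, mul_smul]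
  | add P Q hP hQ => rw [smul_add, map_add, map_add, hP, hQ, smul_add]

theorem isoScalar_normSqPoly : isoScalar normSqPoly = 0 := by
  simp [isoScalar, normSqPoly, Fin.sum_univ_three]

theorem isoEval_Q1 : isoEval (Q1 m) = lowering m := by
  rw [Q1, map_sum, Fin.sum_univ_three, lowering]
  simp only [isoEval_tmul]
  simp [isoScalar]

theorem isoEval_Q1_pow (j : ℕ) : isoEval (Q1 m ^ j) = lowering m ^ j := by
  rw [map_pow, isoEval_Q1]

theorem isoEval_harmonicQ (j : ℕ) : isoEval (harmonicQ m j) = lowering m ^ j := by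
  induction j using Nat.twoStepInduction with
  | zero => exact map_one _
  | one => exact isoEval_Q1.trans (pow_one _).symm
  | more j h0 h1 =>
    have h2 := congrArg isoEval (Q1_mul_harmonicQ (m := m) (j + 1))
    rw [map_add, map_smul, isoEval_smul, isoScalar_normSqPoly, zero_smul, smul_zero, add_zero,
      map_mul, isoEval_Q1, h1, ← pow_succ'] at h2
    exact h2.symm

theorem harmonicQ_ne_zero {j : ℕ} (hj : j ≤ 2 * m) : harmonicQ m j ≠ 0 := by
  intro h
  have h1 := isoEval_harmonicQ (m := m) j
  rw [h, map_zero] at h1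
  exact weightVector_ne_zero hj (DFunLike.congr_fun h1 (highestVector m)).symm

/-! ### Combinations with radial coefficients -/

/-- The combination `∑ pⱼ(|x|²) Rⱼ`. -/
def radialSum (R : ℕ → EndPoly m) (p : ℕ → Polynomial ℂ) : EndPoly m :=
  ∑ j ∈ Finset.range (2 * m + 1), (Polynomial.aeval normSqPoly (p j)) • R j

theorem isoScalar_aeval (p : Polynomial ℂ) :
    isoScalar (Polynomial.aeval normSqPoly p) = p.coeff 0 := by
  rw [← Polynomial.aeval_algHom_apply, isoScalar_normSqPoly, Polynomial.coeff_zero_eq_aeval_zero]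

theorem normSqPoly_ne_zero : normSqPoly ≠ 0 := by
  intro h
  have := congrArg (EuclideanMotion.evalAt ![1, 0, 0]) h
  simp [EuclideanMotion.evalAt, normSqPoly, Fin.sum_univ_three] at this

/-- At the isotropic point the hypothesis reads `0 = ∑ pⱼ(0) Fʲ`, so every `pⱼ` has zero constant
term. The factor `|x|²` then cancels because `EndPoly m` is torsion-free over `Poly`. -/
theorem exists_eq_X_mul_of_normSqPoly_smul_eq {R : ℕ → EndPoly m}
    (hR : ∀ j, isoEval (R j) = lowering m ^ j) {p : ℕ → Polynomial ℂ} {P : EndPoly m}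
    (h : normSqPoly • P = radialSum R p) :
    ∃ q : ℕ → Polynomial ℂ, (∀ j < 2 * m + 1, p j = Polynomial.X * q j) ∧ P = radialSum R q := by
  have h0 : ∀ j < 2 * m + 1, (p j).coeff 0 = 0 := by
    have h1 := congrArg isoEval h
    rw [isoEval_smul, isoScalar_normSqPoly, zero_smul, radialSum, map_sum] at h1
    simp only [isoEval_smul, isoScalar_aeval, hR] at h1
    rw [Finset.sum_range] at h1
    intro j hj
    exact congrFun (lowering_pow_linearIndependent
      (c := fun j : Fin (2 * m + 1) => (p j).coeff 0) h1.symm) ⟨j, hj⟩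
  have hp : ∀ j < 2 * m + 1, p j = Polynomial.X * (p j).divX := fun j hj => by
    conv_lhs => rw [← Polynomial.X_mul_divX_add (p j), h0 j hj, map_zero, add_zero]
  refine ⟨fun j => (p j).divX, hp, ?_⟩
  have h2 : normSqPoly • (P - radialSum R fun j => (p j).divX) = 0 := by
    rw [smul_sub, h, sub_eq_zero, radialSum, radialSum, Finset.smul_sum]
    refine Finset.sum_congr rfl fun j hj => ?_
    conv_lhs => rw [hp j (Finset.mem_range.1 hj), map_mul, Polynomial.aeval_X, mul_smul]
  exact sub_eq_zero.1 (eq_zero_of_smul_eq_zero normSqPoly_ne_zero h2)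

/-- Infinite descent: `|x|²` can be divided out of a relation repeatedly, so every power of `X`
divides each `pⱼ`. -/
theorem radialSum_eq_zero {R : ℕ → EndPoly m} (hR : ∀ j, isoEval (R j) = lowering m ^ j)
    {p : ℕ → Polynomial ℂ} (h : radialSum R p = 0) {j : ℕ} (hj : j < 2 * m + 1) : p j = 0 := by
  have key : ∀ n (p : ℕ → Polynomial ℂ), radialSum R p = 0 →
      ∀ j < 2 * m + 1, Polynomial.X ^ n ∣ p j := by
    intro n
    induction n with
    | zero => exact fun p _ j _ => by simp
    | succ n ih =>
      intro p h j hj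
      obtain ⟨q, hq, h0⟩ := exists_eq_X_mul_of_normSqPoly_smul_eq hR (P := 0)
        ((smul_zero _).trans h.symm)
      rw [hq j hj, pow_succ']
      exact mul_dvd_mul_left _ (ih q h0.symm j hj)
  refine Polynomial.eq_zero_of_dvd_of_natDegree_lt (key ((p j).natDegree + 1) p h j hj) ?_
  simp

theorem aeval_normSqPoly_mem (p : Polynomial ℂ) :
    Polynomial.aeval normSqPoly p ∈ radialPoly := by
  rw [radialPoly, Algebra.adjoin_singleton_eq_range_aeval]
  exact ⟨p, rfl⟩

theorem aeval_smul_mem {N : Submodule radialPoly (EndPoly m)} (p : Polynomial ℂ) {P : EndPoly m}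
    (hP : P ∈ N) : Polynomial.aeval normSqPoly p • P ∈ N :=
  N.smul_mem (⟨_, aeval_normSqPoly_mem p⟩ : radialPoly) hP

theorem radialSum_mem {N : Submodule radialPoly (EndPoly m)} {R : ℕ → EndPoly m}
    (h : ∀ j ≤ 2 * m, R j ∈ N) (p : ℕ → Polynomial ℂ) : radialSum R p ∈ N :=
  Submodule.sum_mem _ fun j hj =>
    aeval_smul_mem _ (h j (Nat.lt_succ_iff.1 (Finset.mem_range.1 hj)))

theorem mem_span_iff {R : ℕ → EndPoly m} {P : EndPoly m} :
    P ∈ Submodule.span radialPoly {P : EndPoly m | ∃ j ≤ 2 * m, P = R j} ↔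
      ∃ p, P = radialSum R p := by
  constructor
  · intro h
    induction h using Submodule.span_induction with
    | mem P h =>
      obtain ⟨j, hj, rfl⟩ := h
      refine ⟨fun i => if i = j then 1 else 0, ?_⟩
      rw [radialSum, Finset.sum_eq_single j]
      · simp
      · intro i _ hi
        simp [hi]
      · intro hj'
        exact absurd (Finset.mem_range.2 (Nat.lt_succ_iff.2 hj)) hj'
    | zero => exact ⟨0, by simp [radialSum]⟩
    | add P Q _ _ hP hQ =>
      obtain ⟨p, rfl⟩ := hP
      obtain ⟨q, rfl⟩ := hQ
      exact ⟨p + q, by simp only [radialSum, Pi.add_apply, map_add, add_smul,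
        Finset.sum_add_distrib]⟩
    | smul c P _ hP =>
      obtain ⟨p, rfl⟩ := hP
      have hc : (c : Poly) ∈ (Polynomial.aeval normSqPoly : Polynomial ℂ →ₐ[ℂ] Poly).range := by
        rw [← Algebra.adjoin_singleton_eq_range_aeval]
        exact c.2
      obtain ⟨d, hd⟩ := hc
      refine ⟨fun j => d * p j, ?_⟩
      change (c : Poly) • radialSum R p = _
      rw [← show _ = (c : Poly) from hd, radialSum, radialSum, Finset.smul_sum]
      exact Finset.sum_congr rfl fun j _ => by rw [map_mul, mul_smul]; rfl
  · rintro ⟨p, rfl⟩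
    refine radialSum_mem (fun j hj => Submodule.subset_span ?_) p
    exact ⟨j, hj, rfl⟩

theorem mem_span_of_normSqPoly_pow_smul_mem {R : ℕ → EndPoly m}
    (hR : ∀ j, isoEval (R j) = lowering m ^ j) (n : ℕ) {P : EndPoly m}
    (h : normSqPoly ^ n • P ∈ Submodule.span radialPoly {P : EndPoly m | ∃ j ≤ 2 * m, P = R j}) :
    P ∈ Submodule.span radialPoly {P : EndPoly m | ∃ j ≤ 2 * m, P = R j} := by
  induction n with
  | zero => rwa [pow_zero, one_smul] at h
  | succ n ih =>
    refine ih ?_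
    rw [pow_succ', mul_smul] at h
    obtain ⟨p, hp⟩ := mem_span_iff.1 h
    obtain ⟨q, -, hq⟩ := exists_eq_X_mul_of_normSqPoly_smul_eq hR hp
    exact mem_span_iff.2 ⟨q, hq⟩

/-! ### Equivariant polynomials on the third axis -/

theorem evalAt_axis (p : Poly) (r : ℝ) :
    (aeval ![0, 0, Polynomial.X] p : Polynomial ℂ).eval (r : ℂ) =
      EuclideanMotion.evalAt ![0, 0, r] p := by
  have h : (Polynomial.aeval (r : ℂ)).comp (aeval ![0, 0, Polynomial.X] : Poly →ₐ[ℂ] _) =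
      EuclideanMotion.evalAt ![0, 0, r] := by
    refine MvPolynomial.algHom_ext fun i => ?_
    fin_cases i <;> simp [EuclideanMotion.evalAt]
  rw [← DFunLike.congr_fun h p, AlgHom.comp_apply, Polynomial.coe_aeval_eq_eval]

theorem evalAt_axis_normSqPoly (r : ℝ) :
    EuclideanMotion.evalAt ![0, 0, r] normSqPoly = (r : ℂ) ^ 2 := by
  simp [EuclideanMotion.evalAt, normSqPoly, Fin.sum_univ_three]

theorem evalAt_axis_Q1_pow (r : ℝ) (j : ℕ) :
    EndPoly.evalAt ![0, 0, r] (Q1 m ^ j) = (r : ℂ) ^ j • dtau m (basisY 2) ^ j := by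
  rw [map_pow, evalAt_Q1, Fin.sum_univ_three, ← smul_pow]
  simp

theorem eq_zero_of_evalAt_axis {P : EndPoly m} (hP : P ∈ equivariantPoly m)
    (h : ∀ r : ℝ, EndPoly.evalAt ![0, 0, r] P = 0) : P = 0 := by
  refine ext_evalAt fun x => ?_
  obtain ⟨k, r, rfl⟩ := SO3.exists_mulVec_eq x
  rw [hP k, h, mul_zero, zero_mul, map_zero]

theorem commute_evalAt_axis {P : EndPoly m} (hP : P ∈ equivariantPoly m) (r θ : ℝ) :
    Commute (EndPoly.evalAt ![0, 0, r] P) (tau m (rotZ θ)) := by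
  have h := hP (rotZ θ) ![0, 0, r]
  rw [rotZ_mulVec] at h
  have h2 := congrArg (· * tau m (rotZ θ)) h
  simp only [mul_assoc, tau_inv_mul_tau, mul_one] at h2
  exact h2

/-- The half turn about the second axis sends `r` to `-r` and `dτ(Y₃)` to its negative. Adding the
expansion of `P(0,0,r)` to the one transported from `-r` yields coefficients of parity `j` without
an appeal to uniqueness. -/
theorem evalAt_axis_eq {P : EndPoly m} (hP : P ∈ equivariantPoly m) :
    ∃ c : ℕ → Polynomial ℂ, ∀ r : ℝ, (2 : ℂ) • EndPoly.evalAt ![0, 0, r] P =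
      ∑ j ∈ Finset.range (2 * m + 1),
        ((c j).eval (r : ℂ) + (-1) ^ j * (c j).eval (-r : ℂ)) • dtau m (basisY 2) ^ j := by
  let c : ℕ → Polynomial ℂ := fun j =>
    aeval ![0, 0, Polynomial.X] (EndPoly.entry (axialCoeff m j) P)
  have h1 : ∀ r : ℝ, EndPoly.evalAt ![0, 0, r] P =
      ∑ j ∈ Finset.range (2 * m + 1), (c j).eval (r : ℂ) • dtau m (basisY 2) ^ j := by
    intro r
    rw [eq_sum_axialCoeff_smul (commute_evalAt_axis hP r _)]
    refine Finset.sum_congr rfl fun j _ => ?_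
    rw [evalAt_axis, evalAt_entry]
  have h2 : ∀ j : ℕ, tau m (rotY Real.pi) * dtau m (basisY 2) ^ j * tau m (rotY Real.pi)⁻¹ =
      (-1 : ℂ) ^ j • dtau m (basisY 2) ^ j := by
    intro j
    -- The conjugation rule is read off from the equivariance of `Q₁^j`, whose value at `(0,0,1)` is
    -- `dτ(Y₃)^j`.
    have h := Q1_pow_mem_equivariantPoly (m := m) j (rotY Real.pi) ![0, 0, 1]
    rw [rotY_pi_mulVec, evalAt_axis_Q1_pow, evalAt_axis_Q1_pow] at h
    simpa using h.symm
  have h3 : ∀ r : ℝ, EndPoly.evalAt ![0, 0, r] P = ∑ j ∈ Finset.range (2 * m + 1),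
      ((-1) ^ j * (c j).eval (-r : ℂ)) • dtau m (basisY 2) ^ j := by
    intro r
    have h := hP (rotY Real.pi) ![0, 0, -r]
    rw [rotY_pi_mulVec, neg_neg, h1 (-r), Finset.mul_sum, Finset.sum_mul] at h
    rw [h]
    refine Finset.sum_congr rfl fun j _ => ?_
    rw [mul_smul_comm, smul_mul_assoc, h2, smul_smul, mul_comm, Complex.ofReal_neg]
  refine ⟨c, fun r => ?_⟩
  simp only [add_smul, Finset.sum_add_distrib]
  rw [← h1, ← h3, two_smul]

/-- Only monomials of the parity of `j` survive symmetrization. The factor `r^{2m}` guarantees that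
`r^j` can be split off, leaving an even power. -/
theorem exists_eval_sq_eq (j : ℕ) (hj : j ≤ 2 * m) (c : Polynomial ℂ) :
    ∃ d : Polynomial ℂ, ∀ r : ℂ,
      r ^ (2 * m) * (c.eval r + (-1) ^ j * c.eval (-r)) = d.eval (r ^ 2) * r ^ j := by
  induction c using Polynomial.induction_on' with
  | add p q hp hq =>
    obtain ⟨d, hd⟩ := hp
    obtain ⟨e, he⟩ := hq
    refine ⟨d + e, fun r => ?_⟩
    simp only [Polynomial.eval_add, add_mul, ← hd, ← he]
    ring
  | monomial n a =>
    rcases Nat.even_or_odd (n + j) with h | h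
    · obtain ⟨k, hk⟩ : ∃ k, 2 * m + n = 2 * k + j := by
        obtain ⟨l, hl⟩ := h
        exact ⟨m + l - j, by omega⟩
      refine ⟨Polynomial.monomial k (2 * a), fun r => ?_⟩
      have h1 : (-1 : ℂ) ^ j * (-r) ^ n = r ^ n := by
        rw [neg_pow r n, ← mul_assoc, ← pow_add, add_comm j n, h.neg_one_pow, one_mul]
      have h2 : r ^ (2 * m) * r ^ n = (r ^ 2) ^ k * r ^ j := by
        rw [← pow_add, hk, pow_add, pow_mul]
      simp only [Polynomial.eval_monomial]
      linear_combination (a * r ^ (2 * m)) * h1 + (2 * a) * h2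
    · refine ⟨0, fun r => ?_⟩
      have h1 : (-1 : ℂ) ^ j * (-r) ^ n = -r ^ n := by
        rw [neg_pow r n, ← mul_assoc, ← pow_add, add_comm j n, h.neg_one_pow, neg_one_mul]
      simp only [Polynomial.eval_monomial, Polynomial.eval_zero]
      linear_combination (a * r ^ (2 * m)) * h1

theorem evalAt_axis_aeval (d : Polynomial ℂ) (r : ℝ) :
    EuclideanMotion.evalAt ![0, 0, r] (Polynomial.aeval normSqPoly d) = d.eval ((r : ℂ) ^ 2) := by
  rw [← Polynomial.aeval_algHom_apply, evalAt_axis_normSqPoly, Polynomial.coe_aeval_eq_eval]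

/-- Both sides of the desired identity are equivariant, so agreement on the third axis suffices.
There `|x|² = r²` and `Q₁^j = r^j dτ(Y₃)^j`, which is the shape that `exists_eval_sq_eq` produces.
-/
theorem normSqPoly_pow_smul_mem_span {P : EndPoly m} (hP : P ∈ equivariantPoly m) :
    normSqPoly ^ m • P ∈
      Submodule.span radialPoly {P : EndPoly m | ∃ j ≤ 2 * m, P = Q1 m ^ j} := by
  obtain ⟨c, hc⟩ := evalAt_axis_eq hP
  choose! d hd using fun j (hj : j ≤ 2 * m) => exists_eval_sq_eq j hj (c j)
  have hN : normSqPoly ^ m • P ∈ equivariantPoly m :=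
    (equivariantPoly m).smul_mem (⟨normSqPoly ^ m, pow_mem normSqPoly_mem m⟩ : radialPoly) hP
  have h : (2 : ℂ) • normSqPoly ^ m • P = radialSum (fun j => Q1 m ^ j) d := by
    rw [← sub_eq_zero]
    refine eq_zero_of_evalAt_axis (Submodule.sub_mem _ (smul_mem_radial _ hN)
      (radialSum_mem (fun j _ => Q1_pow_mem_equivariantPoly j) d)) fun r => ?_
    rw [map_sub, map_smul, EndPoly.evalAt_smul, map_pow, evalAt_axis_normSqPoly, smul_comm, hc,
      radialSum, map_sum, Finset.smul_sum, ← pow_mul]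
    refine sub_eq_zero.2 (Finset.sum_congr rfl fun j hj => ?_)
    rw [EndPoly.evalAt_smul, evalAt_axis_aeval, evalAt_axis_Q1_pow, smul_smul, smul_smul,
      hd j (Nat.lt_succ_iff.1 (Finset.mem_range.1 hj))]
  have h2 : normSqPoly ^ m • P = (2⁻¹ : ℂ) • radialSum (fun j => Q1 m ^ j) d := by
    rw [← h, smul_smul, inv_mul_cancel₀ two_ne_zero, one_smul]
  rw [h2]
  exact smul_mem_radial _ (mem_span_iff.2 ⟨d, rfl⟩)

/-! ### The two generating families of `𝒫_τ`. -/

theorem span_Q1_pow_eq :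
    Submodule.span radialPoly {P : EndPoly m | ∃ j ≤ 2 * m, P = Q1 m ^ j} = equivariantPoly m := by
  refine le_antisymm (Submodule.span_le.2 ?_) fun P hP => ?_
  · rintro _ ⟨j, -, rfl⟩
    exact Q1_pow_mem_equivariantPoly j
  · exact mem_span_of_normSqPoly_pow_smul_mem isoEval_Q1_pow m (normSqPoly_pow_smul_mem_span hP)

/-- The recursion, read as a formula for `Q₁Q_i`, shows that multiplication by `Q₁` raises the
largest index by at most one. -/
theorem Q1_pow_mem_span_harmonicQ (j : ℕ) :
    Q1 m ^ j ∈ Submodule.span radialPoly {P : EndPoly m | ∃ i ≤ j, P = harmonicQ m i} := by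
  induction j with
  | zero => exact pow_zero (Q1 m) ▸ Submodule.subset_span ⟨0, le_rfl, rfl⟩
  | succ j ih =>
    rw [pow_succ']
    generalize Q1 m ^ j = P at ih
    induction ih using Submodule.span_induction with
    | mem P h =>
      obtain ⟨i, hi, rfl⟩ := h
      rw [Q1_mul_harmonicQ]
      exact Submodule.add_mem _ (Submodule.subset_span ⟨i + 1, by omega, rfl⟩)
        (smul_mem_radial _ (normSqPoly_smul_mem (Submodule.subset_span ⟨i - 1, by omega, rfl⟩)))
    | zero => exact (mul_zero (Q1 m)).symm ▸ Submodule.zero_mem _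
    | add P Q _ _ hP hQ =>
      rw [mul_add]
      exact Submodule.add_mem _ hP hQ
    | smul c P _ hP =>
      have : Q1 m * c • P = c • (Q1 m * P) := mul_smul_comm (c : Poly) (Q1 m) P
      rw [this]
      exact Submodule.smul_mem _ c hP

theorem span_harmonicQ_eq :
    Submodule.span radialPoly {P : EndPoly m | ∃ j ≤ 2 * m, P = harmonicQ m j} =
      equivariantPoly m := by
  refine le_antisymm (Submodule.span_le.2 ?_) ?_
  · rintro _ ⟨j, -, rfl⟩
    exact harmonicQ_mem_equivariantPoly j
  · rw [← span_Q1_pow_eq, Submodule.span_le]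
    rintro _ ⟨j, hj, rfl⟩
    refine Submodule.span_mono ?_ (Q1_pow_mem_span_harmonicQ j)
    rintro _ ⟨i, hi, rfl⟩
    exact ⟨i, hi.trans hj, rfl⟩

/-! ### Harmonic equivariant polynomials -/

/-- In the variable `s = |x|²`, the Laplacian acts on the radial factor of `d(s) q` as `4s d'' +
(4i+6) d'`; the term `4i` comes from Euler's relation for `q`. -/
theorem laplacian_aeval_mul {i : ℕ} {q : Poly} (hq : q ∈ harmonic i) (d : Polynomial ℂ) :
    laplacian (Polynomial.aeval normSqPoly d * q) = Polynomial.aeval normSqPoly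
      (4 * Polynomial.X * d.derivative.derivative + (4 * (i : Polynomial ℂ) + 6) * d.derivative) * q := by
  obtain ⟨h1, h2⟩ := hq
  have h1' : q.IsHomogeneous i := h1
  have h2' : laplacian q = 0 := h2
  have he := h1'.sum_X_mul_pderiv
  have hA : ∀ k (e : Polynomial ℂ), pderiv k (Polynomial.aeval normSqPoly e) =
      Polynomial.aeval normSqPoly e.derivative * (2 * X k) := fun k e => by
    rw [Derivation.map_aeval, pderiv_normSqPoly, smul_eq_mul]
  have h2X : ∀ k : Fin 3, pderiv k (2 * X k : Poly) = 2 := fun k => by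
    rw [← map_ofNat (C : ℂ →+* Poly) 2, pderiv_C_mul, pderiv_X_self, mul_one]
  have hn : normSqPoly = X 0 ^ 2 + X 1 ^ 2 + X 2 ^ 2 := Fin.sum_univ_three _
  rw [laplacian_apply] at h2' ⊢
  rw [Fin.sum_univ_three] at h2' he ⊢
  simp only [pderiv_mul, map_add, hA, h2X, map_mul, map_natCast, Polynomial.aeval_X, map_ofNat,
    nsmul_eq_mul] at h2' he ⊢
  generalize Polynomial.aeval normSqPoly d = a₀ at *
  generalize Polynomial.aeval normSqPoly d.derivative = a₁ at *
  generalize Polynomial.aeval normSqPoly d.derivative.derivative = a₂ at *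
  rw [hn]
  linear_combination a₀ * h2' + 4 * a₁ * he

/-- On `g = d'` the operator is diagonal on monomials: it multiplies the `n`-th coefficient by `4n +
4i + 6`, which never vanishes. -/
theorem eq_C_of_radial_laplacian_eq_zero {i : ℕ} {d : Polynomial ℂ}
    (h : 4 * Polynomial.X * d.derivative.derivative + (4 * (i : Polynomial ℂ) + 6) * d.derivative = 0) :
    d = Polynomial.C (d.coeff 0) := by
  refine Polynomial.eq_C_of_natDegree_eq_zero (Polynomial.derivative_eq_zero.1 ?_)
  generalize d.derivative = g at h
  ext n
  have h1 := congrArg (fun f => Polynomial.coeff f n) h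
  have e : (4 * Polynomial.X * Polynomial.derivative g + (4 * (i : Polynomial ℂ) + 6) * g : Polynomial ℂ) =
      Polynomial.C 4 * (Polynomial.X * Polynomial.derivative g) +
        Polynomial.C (4 * (i : ℂ) + 6) * g := by
    simp only [map_add, map_mul, map_natCast, map_ofNat]
    ring
  simp only [e, Polynomial.coeff_add, Polynomial.coeff_C_mul, Polynomial.coeff_zero] at h1
  have h2 : (Polynomial.X * Polynomial.derivative g).coeff n = n * g.coeff n := by
    cases n with
    | zero => simp
    | succ n =>
      rw [Polynomial.coeff_X_mul, Polynomial.coeff_derivative]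
      push_cast
      ring
  rw [h2] at h1
  have h3 : ((4 * n + 4 * i + 6 : ℕ) : ℂ) * g.coeff n = 0 := by
    push_cast
    linear_combination h1
  rw [Polynomial.coeff_zero]
  exact (mul_eq_zero.1 h3).resolve_left (by exact_mod_cast (by omega : 4 * n + 4 * i + 6 ≠ 0))

/-- Expand `P` in the `Q_i`. By independence over `ℂ[|x|²]`, `ΔP = 0` makes the coefficients
constant, and homogeneity of degree `j` then leaves only `Q_j`. -/
theorem harmonicEquivariant_eq_span {j : ℕ} (hj : j ≤ 2 * m) :
    harmonicEquivariant m j = Submodule.span ℂ {harmonicQ m j} := by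
  refine le_antisymm (fun P hP => ?_) ?_
  · obtain ⟨hE, hH⟩ := harmonicEquivariant_iff.1 hP
    rw [← span_harmonicQ_eq] at hE
    obtain ⟨p, rfl⟩ := mem_span_iff.1 hE
    have hL : radialSum (harmonicQ m) (fun i => 4 * Polynomial.X * (p i).derivative.derivative +
        (4 * (i : Polynomial ℂ) + 6) * (p i).derivative) = 0 := by
      rw [← hH.laplacian_eq_zero]
      refine ext_entry fun φ => ?_
      simp only [radialSum, map_sum, entry_entrywise, entry_smul]
      exact Finset.sum_congr rfl fun i _ =>
        (laplacian_aeval_mul ((harmonicQ_spec i).1 φ) (p i)).symm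
    have hC : ∀ i < 2 * m + 1, p i = Polynomial.C ((p i).coeff 0) := fun i hi =>
      eq_C_of_radial_laplacian_eq_zero (radialSum_eq_zero isoEval_harmonicQ hL hi)
    have hS : radialSum (harmonicQ m) p =
        ∑ i ∈ Finset.range (2 * m + 1), (p i).coeff 0 • harmonicQ m i := by
      refine Finset.sum_congr rfl fun i hi => ?_
      conv_lhs => rw [hC i (Finset.mem_range.1 hi), Polynomial.aeval_C]
      exact algebraMap_smul _ _ _
    -- Euler's relation for `P` minus the ones for the `Q_i`: the relation has coefficients `pᵢ(0)(i
    -- - j)`, which independence forces to vanish.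
    have hZ : radialSum (harmonicQ m)
        (fun i => Polynomial.C ((p i).coeff 0 * ((i : ℂ) - j))) = 0 := by
      have h1 := hH.euler
      rw [hS] at h1
      simp only [map_sum, map_smul, Finset.smul_sum] at h1
      rw [Finset.sum_comm] at h1
      have h2 : ∀ i, ∑ k : Fin 3, (X k : Poly) • (p i).coeff 0 • pd k (harmonicQ m i) =
          ((p i).coeff 0 * i) • harmonicQ m i := by
        intro i
        rw [mul_smul, ← (harmonicQ_spec i).1.euler, Finset.smul_sum]
        exact Finset.sum_congr rfl fun k _ => smul_comm _ _ _
      simp only [h2] at h1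
      rw [← sub_eq_zero, ← Finset.sum_sub_distrib] at h1
      rw [← h1]
      refine Finset.sum_congr rfl fun i _ => ?_
      rw [Polynomial.aeval_C, algebraMap_smul, smul_smul, mul_comm (j : ℂ), mul_sub]
      exact sub_smul _ _ _
    rw [hS, Finset.sum_eq_single j]
    · exact Submodule.smul_mem _ _ (Submodule.mem_span_singleton_self _)
    · intro i hi hij
      have h1 := radialSum_eq_zero isoEval_harmonicQ hZ (Finset.mem_range.1 hi)
      rw [Polynomial.C_eq_zero] at h1
      have h2 : (i : ℂ) - j ≠ 0 := sub_ne_zero.2 (by exact_mod_cast hij)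
      rw [(mul_eq_zero.1 h1).resolve_right h2, zero_smul]
    · exact fun h => absurd (Finset.mem_range.2 (Nat.lt_succ_iff.2 hj)) h
  · rw [Submodule.span_singleton_le_iff_mem, harmonicEquivariant_iff]
    exact ⟨harmonicQ_mem_equivariantPoly j, (harmonicQ_spec j).1⟩

end EndPoly

end EuclideanMotion

end

open EuclideanMotion
theorem proposition1 (m : ℕ) :
    Submodule.span radialPoly {P : EndPoly m | ∃ j ≤ 2 * m, P = Q1 m ^ j} = equivariantPoly m ∧
    ∃ Q : ℕ → EndPoly m,
      Q 0 = 1 ∧ Q 1 = Q1 m ∧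
      (∀ j ≤ 2 * m, Q j ≠ 0 ∧ harmonicEquivariant m j = Submodule.span ℂ {Q j}) ∧
      (∀ j, 1 ≤ j → j ≤ 2 * m → Dtau m (Q j) = coeffA m j • Q (j - 1)) ∧
      (∀ j, 1 ≤ j → j < 2 * m →
        Q (j + 1) = Q1 m * Q j - (1 / (2 * j + 1) : ℂ) • normSqPoly • Dtau m (Q j) ∧
        Q (j + 1) = Q1 m * Q j - (coeffA m j / (2 * j + 1)) • normSqPoly • Q (j - 1)) ∧
      Submodule.span radialPoly {P : EndPoly m | ∃ j ≤ 2 * m, P = Q j} = equivariantPoly m := by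
  refine ⟨EndPoly.span_Q1_pow_eq, EndPoly.harmonicQ m, rfl, rfl,
    fun j hj => ⟨EndPoly.harmonicQ_ne_zero hj, EndPoly.harmonicEquivariant_eq_span hj⟩,
    fun j _ _ => (EndPoly.harmonicQ_spec j).2, fun j _ _ => ⟨?_, EndPoly.harmonicQ_succ j⟩,
    EndPoly.span_harmonicQ_eq⟩
  rw [(EndPoly.harmonicQ_spec j).2, EndPoly.harmonicQ_succ, smul_comm normSqPoly (coeffA m j),
    smul_smul, one_div_mul_eq_div]
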